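/- Let $d\ge 1$, let $\lambda,\mu\in\mathbb R$ satisfy $\mu>0$ and $\lambda+2\mu>0$, and let $\gamma\ge \tfrac12$ if $d=1$, $\gamma>0$ if $d=2$, and $\gamma\ge 0$ if $d\ge 3$. For a measurable function $V:\mathbb R^d\to\mathbb R$ let $V_-:=\max\{-V,0\}$, and let $-\Delta^*+V$, with $\Delta^*u=\mu\Delta u+(\lambda+\mu)\nabla\operatorname{div}u$, be the perturbed Lamé operator on $[L^2(\mathbb R^d;\mathbb C)]^d$, that is, the operator associated with the sesquilinear form $$h(v,u)=\mu\sum_{j=1}^d\langle\partial_j v,\partial_j u\rangle_{[L^2]^d}+(\lambda+\mu)\langle\operatorname{div}v,\operatorname{div}u\rangle_{L^2}+\int_{\mathbb R^d}V\,\overline{v}\cdot u\,dx$$ on the form domain $Q=\{u\in[H^1(\mathbb R^d)]^d:\int_{\mathbb R^d}|V||u|^2\,dx<\infty\}$: a vector $u$ lies in its domain and $(-\Delta^*+V)u=f$ if and only if $u\in Q$, $f\in\overline{Q}$ (the closure in $[L^2]^d$, which is all of $[L^2]^d$ for instance if $V\in L^1_{\mathrm{loc}}$), and $h(v,u)=\langle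 v,f\rangle$ for all $v\in Q$. When $V_-\in L^{\gamma+d/2}(\mathbb R^d)$ the form is closed and bounded below, and this is the self-adjoint operator given by the representation theorem for forms. Then there is a constant $C=C_{\gamma,d,\lambda,\mu}>0$, independent of $V$, such that for every measurable $V:\mathbb R^d\to\mathbb R$ every negative eigenvalue $z$ of $-\Delta^*+V$ satisfies $$|z|^\gamma\le C\,\|V_-\|_{L^{\gamma+d/2}(\mathbb R^d)}^{\gamma+d/2}$$ (the right-hand side being $+\infty$ if $V_-\notin L^{\gamma+d/2}(\mathbb R^d)$). -/

import Mathlib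

open MeasureTheory
open scoped LineDeriv SchwartzMap ComplexConjugate

noncomputable section

namespace Lame

/-- The Hilbert space `[L²(ℝᵈ)]ᵈ` of (complex) square-integrable vector fields on `ℝᵈ`. -/
abbrev VField (d : ℕ) : Type :=
  Lp (EuclideanSpace ℂ (Fin d)) 2 (volume : Measure (EuclideanSpace ℝ (Fin d)))

/-- `g` is the weak (distributional) partial derivative `∂ⱼ u` of the vector field `u`,
taken componentwise. -/
def IsWeakPartial {d : ℕ} (j : Fin d) (u g : VField d) : Prop :=
  ∂_{(EuclideanSpace.single j (1 : ℝ) : EuclideanSpace ℝ (Fin d))}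
    (Lp.toTemperedDistribution u) = Lp.toTemperedDistribution g

theorem IsWeakPartial.add {d : ℕ} {j : Fin d} {u u' g g' : VField d}
    (h : IsWeakPartial j u g) (h' : IsWeakPartial j u' g') :
    IsWeakPartial j (u + u') (g + g') := by
  unfold IsWeakPartial at *
  simp only [← Lp.toTemperedDistributionCLM_apply, map_add] at *
  rw [LineDeriv.lineDerivOp_add, h, h']

theorem IsWeakPartial.smul {d : ℕ} {j : Fin d} {u g : VField d} (c : ℂ)
    (h : IsWeakPartial j u g) : IsWeakPartial j (c • u) (c • g) := by
  unfold IsWeakPartial at *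
  simp only [← Lp.toTemperedDistributionCLM_apply, map_smul] at *
  rw [LineDeriv.lineDerivOp_smul, h]

theorem IsWeakPartial.zero {d : ℕ} (j : Fin d) : IsWeakPartial j (0 : VField d) 0 := by
  unfold IsWeakPartial
  simp only [← Lp.toTemperedDistributionCLM_apply, map_zero]
  rw [LineDeriv.lineDerivOp_zero]

theorem IsWeakPartial.unique {d : ℕ} {j : Fin d} {u g g' : VField d}
    (h : IsWeakPartial j u g) (h' : IsWeakPartial j u g') : g = g' := by
  unfold IsWeakPartial at *
  have h2 : Lp.toTemperedDistribution g = Lp.toTemperedDistribution g' := h.symm.trans h'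
  simp only [← Lp.toTemperedDistributionCLM_apply] at h2
  exact LinearMap.ker_eq_bot.1
    (Lp.ker_toTemperedDistributionCLM_eq_bot
      (F := EuclideanSpace ℂ (Fin d)) (μ := (volume : Measure (EuclideanSpace ℝ (Fin d)))) (p := 2))
    h2

/-- The Sobolev space `[H¹(ℝᵈ)]ᵈ`. -/
def H1 (d : ℕ) : Submodule ℂ (VField d) where
  carrier := {u | ∀ j : Fin d, ∃ g : VField d, IsWeakPartial j u g}
  add_mem' := fun hu hv j =>
    let ⟨g, hg⟩ := hu j
    let ⟨g', hg'⟩ := hv j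
    ⟨g + g', hg.add hg'⟩
  zero_mem' := fun j => ⟨0, IsWeakPartial.zero j⟩
  smul_mem' := fun c _ hu j =>
    let ⟨g, hg⟩ := hu j
    ⟨c • g, hg.smul c⟩

open Classical in
/-- The weak partial derivative `∂ⱼ u`, an element of `[L²(ℝᵈ)]ᵈ` (it is only used for
`u ∈ [H¹(ℝᵈ)]ᵈ`, and is `0` by convention if there is no such element). -/
def weakPartial {d : ℕ} (j : Fin d) (u : VField d) : VField d :=
  if h : ∃ g : VField d, IsWeakPartial j u g then h.choose else 0

theorem weakPartial_spec {d : ℕ} {u : VField d} (hu : u ∈ H1 d) (j : Fin d) :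
    IsWeakPartial j u (weakPartial j u) := by
  have h : ∃ g : VField d, IsWeakPartial j u g := hu j
  rw [weakPartial, dif_pos h]
  exact h.choose_spec

theorem weakPartial_eq {d : ℕ} {j : Fin d} {u g : VField d} (h : IsWeakPartial j u g) :
    weakPartial j u = g := by
  have h' : ∃ g : VField d, IsWeakPartial j u g := ⟨g, h⟩
  rw [weakPartial, dif_pos h']
  exact h'.choose_spec.unique h

theorem weakPartial_add {d : ℕ} {u v : VField d} (hu : u ∈ H1 d) (hv : v ∈ H1 d) (j : Fin d) :
    weakPartial j (u + v) = weakPartial j u + weakPartial j v :=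
  weakPartial_eq ((weakPartial_spec hu j).add (weakPartial_spec hv j))

theorem weakPartial_smul {d : ℕ} {u : VField d} (c : ℂ) (hu : u ∈ H1 d) (j : Fin d) :
    weakPartial j (c • u) = c • weakPartial j u :=
  weakPartial_eq ((weakPartial_spec hu j).smul c)

theorem weakPartial_zero {d : ℕ} (j : Fin d) : weakPartial j (0 : VField d) = 0 :=
  weakPartial_eq (IsWeakPartial.zero j)

/-- The divergence `div u = ∑ⱼ ∂ⱼ uⱼ`. -/
def weakDiv {d : ℕ} (u : VField d) (x : EuclideanSpace ℝ (Fin d)) : ℂ :=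
  ∑ j : Fin d, weakPartial j u x j

theorem memLp_weakDiv {d : ℕ} (u : VField d) : MemLp (weakDiv u) 2 volume := by
  unfold weakDiv
  refine memLp_finsetSum _ fun j _ => ?_
  exact (EuclideanSpace.proj (𝕜 := ℂ) j : EuclideanSpace ℂ (Fin d) →L[ℂ] ℂ).comp_memLp' (Lp.memLp _)

theorem weakDiv_add {d : ℕ} {u v : VField d} (hu : u ∈ H1 d) (hv : v ∈ H1 d) :
    weakDiv (u + v) =ᵐ[volume] fun x => weakDiv u x + weakDiv v x := by
  have h : ∀ j : Fin d, ∀ᵐ x ∂volume,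
      weakPartial j (u + v) x = weakPartial j u x + weakPartial j v x := fun j => by
    rw [weakPartial_add hu hv]
    exact Lp.coeFn_add _ _
  filter_upwards [ae_all_iff.2 h] with x hx
  simp [weakDiv, hx, Finset.sum_add_distrib]

theorem weakDiv_smul {d : ℕ} {u : VField d} (c : ℂ) (hu : u ∈ H1 d) :
    weakDiv (c • u) =ᵐ[volume] fun x => c * weakDiv u x := by
  have h : ∀ j : Fin d, ∀ᵐ x ∂volume, weakPartial j (c • u) x = c • weakPartial j u x := fun j => by
    rw [weakPartial_smul c hu]
    exact Lp.coeFn_smul _ _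
  filter_upwards [ae_all_iff.2 h] with x hx
  simp [weakDiv, hx, Finset.mul_sum]

/-- The sesquilinear form of `-Δ* + V`, with `Δ* u = mu Δ u + (lam + mu) ∇ div u`:
`h(v, u) = mu ∑ⱼ ⟨∂ⱼ v, ∂ⱼ u⟩ + (lam + mu) ⟨div v, div u⟩ + ∫ V ⟨v, u⟩`,
conjugate-linear in the first argument. -/
def lameForm {d : ℕ} (lam mu : ℝ) (V : EuclideanSpace ℝ (Fin d) → ℝ) (v u : VField d) : ℂ :=
  (mu : ℂ) * (∑ j : Fin d, inner ℂ (weakPartial j v) (weakPartial j u))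
    + ((lam + mu : ℝ) : ℂ) * (∫ x, conj (weakDiv v x) * weakDiv u x)
    + (∫ x, (V x : ℂ) * inner ℂ (v x) (u x))

theorem integrable_potential {d : ℕ} {V : EuclideanSpace ℝ (Fin d) → ℝ} {u v : VField d}
    (hu : Integrable (fun x => V x * ‖u x‖ ^ 2) volume)
    (hv : Integrable (fun x => V x * ‖v x‖ ^ 2) volume) :
    Integrable (fun x => (V x : ℂ) * inner ℂ (v x) (u x)) volume := by
  have hum := Lp.aestronglyMeasurable u
  have hvm := Lp.aestronglyMeasurable v
  have hq : AEStronglyMeasurable (fun x => ((‖u x‖ ^ 2)⁻¹ : ℝ)) volume :=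
    ((hum.norm.aemeasurable.pow_const 2).inv).aestronglyMeasurable
  refine Integrable.mono' (hu.norm.add hv.norm) ?_ ?_
  · have h1 : AEStronglyMeasurable
        (fun x => ((V x * ‖u x‖ ^ 2 * (‖u x‖ ^ 2)⁻¹ : ℝ) : ℂ) * inner ℂ (v x) (u x)) volume :=
      (Complex.continuous_ofReal.comp_aestronglyMeasurable (hu.1.mul hq)).mul
        (hvm.inner hum)
    refine h1.congr (Filter.Eventually.of_forall fun x => ?_)
    by_cases h0 : u x = 0
    · simp [h0]
    · have h0' : ‖u x‖ ^ 2 ≠ 0 := by simpa using h0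
      simp only
      rw [mul_assoc, mul_inv_cancel₀ h0', mul_one]
  · refine Filter.Eventually.of_forall fun x => ?_
    have h1 : ‖(inner ℂ (v x) (u x) : ℂ)‖ ≤ ‖v x‖ * ‖u x‖ := norm_inner_le_norm _ _
    have h2 : ‖v x‖ * ‖u x‖ ≤ ‖u x‖ ^ 2 + ‖v x‖ ^ 2 := by
      nlinarith [sq_nonneg (‖v x‖ - ‖u x‖), sq_nonneg (‖v x‖), sq_nonneg (‖u x‖)]
    calc ‖(V x : ℂ) * inner ℂ (v x) (u x)‖ = |V x| * ‖(inner ℂ (v x) (u x) : ℂ)‖ := by simp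
      _ ≤ |V x| * (‖u x‖ ^ 2 + ‖v x‖ ^ 2) := by gcongr; exact h1.trans h2
      _ = ‖V x * ‖u x‖ ^ 2‖ + ‖V x * ‖v x‖ ^ 2‖ := by simp [mul_add]

theorem integrable_div {d : ℕ} (u v : VField d) :
    Integrable (fun x => conj (weakDiv v x) * weakDiv u x) volume := by
  have := MemLp.integrable_mul (memLp_weakDiv v).star (memLp_weakDiv u)
  exact this

/-- The form domain `Q(V) = {u ∈ [H¹(ℝᵈ)]ᵈ : ∫ |V| |u|² < ∞}`. -/
def formDomain {d : ℕ} (V : EuclideanSpace ℝ (Fin d) → ℝ) : Submodule ℂ (VField d) where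
  carrier := {u | u ∈ H1 d ∧ Integrable (fun x => V x * ‖u x‖ ^ 2) volume}
  zero_mem' := by
    refine ⟨(H1 d).zero_mem, (integrable_zero _ ℝ volume).congr ?_⟩
    filter_upwards [Lp.coeFn_zero (EuclideanSpace ℂ (Fin d)) 2
      (volume : Measure (EuclideanSpace ℝ (Fin d)))] with x hx
    simp [hx]
  add_mem' := by
    rintro u v ⟨hu, hu'⟩ ⟨hv, hv'⟩
    refine ⟨(H1 d).add_mem hu hv, ?_⟩
    have h := ((hu'.add hv').add ((integrable_potential hu' hv').re)).add
      ((integrable_potential hu' hv').re)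
    refine h.congr ?_
    filter_upwards [Lp.coeFn_add u v] with x hx
    have h2 := @norm_add_sq ℂ _ _ _ _ (v x) (u x)
    simp only [Pi.add_apply] at hx ⊢
    rw [hx, add_comm (u x) (v x), h2]
    simp
    ring
  smul_mem' := by
    rintro c u ⟨hu, hu'⟩
    refine ⟨(H1 d).smul_mem c hu, (hu'.const_mul (‖c‖ ^ 2)).congr ?_⟩
    filter_upwards [Lp.coeFn_smul c u] with x hx
    rw [hx, Pi.smul_apply, norm_smul]
    ring

theorem lameForm_add_right {d : ℕ} (lam mu : ℝ) {V : EuclideanSpace ℝ (Fin d) → ℝ}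
    {v u u' : VField d} (hv : v ∈ formDomain V) (hu : u ∈ formDomain V) (hu' : u' ∈ formDomain V) :
    lameForm lam mu V v (u + u') = lameForm lam mu V v u + lameForm lam mu V v u' := by
  have h1 : ∫ x, conj (weakDiv v x) * weakDiv (u + u') x
      = (∫ x, conj (weakDiv v x) * weakDiv u x) + ∫ x, conj (weakDiv v x) * weakDiv u' x := by
    rw [← integral_add (integrable_div _ _) (integrable_div _ _)]
    refine integral_congr_ae ?_
    filter_upwards [weakDiv_add hu.1 hu'.1] with x hx
    rw [hx, mul_add]
  have h2 : ∫ x, (V x : ℂ) * inner ℂ (v x) ((u + u' : VField d) x)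
      = (∫ x, (V x : ℂ) * inner ℂ (v x) (u x)) + ∫ x, (V x : ℂ) * inner ℂ (v x) (u' x) := by
    rw [← integral_add (integrable_potential hu.2 hv.2) (integrable_potential hu'.2 hv.2)]
    refine integral_congr_ae ?_
    filter_upwards [Lp.coeFn_add u u'] with x hx
    rw [hx, Pi.add_apply, inner_add_right, mul_add]
  unfold lameForm
  simp only [h1, h2, weakPartial_add hu.1 hu'.1, inner_add_right, Finset.sum_add_distrib]
  ring

theorem lameForm_smul_right {d : ℕ} (lam mu : ℝ) {V : EuclideanSpace ℝ (Fin d) → ℝ}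
    (v : VField d) {u : VField d} (c : ℂ) (hu : u ∈ formDomain V) :
    lameForm lam mu V v (c • u) = c * lameForm lam mu V v u := by
  have h1 : ∫ x, conj (weakDiv v x) * weakDiv (c • u) x
      = c * ∫ x, conj (weakDiv v x) * weakDiv u x := by
    rw [← integral_const_mul]
    refine integral_congr_ae ?_
    filter_upwards [weakDiv_smul c hu.1] with x hx
    rw [hx]; ring
  have h2 : ∫ x, (V x : ℂ) * inner ℂ (v x) ((c • u : VField d) x)
      = c * ∫ x, (V x : ℂ) * inner ℂ (v x) (u x) := by
    rw [← integral_const_mul]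
    refine integral_congr_ae ?_
    filter_upwards [Lp.coeFn_smul c u] with x hx
    rw [hx, Pi.smul_apply, inner_smul_right]; ring
  unfold lameForm
  simp only [h1, h2, weakPartial_smul c hu.1, inner_smul_right, ← Finset.mul_sum]
  ring

theorem lameForm_zero_right {d : ℕ} (lam mu : ℝ) (V : EuclideanSpace ℝ (Fin d) → ℝ)
    (v : VField d) : lameForm lam mu V v 0 = 0 := by
  have := lameForm_smul_right lam mu v 0 (formDomain V).zero_mem
  simpa using this

/-- The graph of the operator associated with the form `lameForm lam mu V` on `formDomain V`:
the pairs `(u, f)` with `u ∈ Q(V)` and `h(v, u) = ⟨v, f⟩` for all `v ∈ Q(V)`. The vector `f` lies in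
the closure of `Q(V)`; this is no condition when `Q(V)` is dense, as for locally integrable `V`. -/
def lameGraph {d : ℕ} (lam mu : ℝ) (V : EuclideanSpace ℝ (Fin d) → ℝ) :
    Submodule ℂ (VField d × VField d) where
  carrier := {p | p.1 ∈ formDomain V ∧ p.2 ∈ (formDomain V).topologicalClosure ∧
    ∀ v ∈ formDomain V, lameForm lam mu V v p.1 = inner ℂ v p.2}
  zero_mem' := ⟨(formDomain V).zero_mem, Submodule.zero_mem _, fun v _ => by
    simp [lameForm_zero_right]⟩
  add_mem' := by
    rintro p q ⟨hp, hp', hp''⟩ ⟨hq, hq', hq''⟩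
    refine ⟨(formDomain V).add_mem hp hq, Submodule.add_mem _ hp' hq', fun v hv => ?_⟩
    rw [Prod.fst_add, Prod.snd_add, lameForm_add_right lam mu hv hp hq, inner_add_right,
      hp'' v hv, hq'' v hv]
  smul_mem' := by
    rintro c p ⟨hp, hp', hp''⟩
    refine ⟨(formDomain V).smul_mem c hp, Submodule.smul_mem _ c hp', fun v hv => ?_⟩
    rw [Prod.smul_fst, Prod.smul_snd, lameForm_smul_right lam mu v c hp, inner_smul_right,
      hp'' v hv]

theorem lameGraph_functional {d : ℕ} (lam mu : ℝ) (V : EuclideanSpace ℝ (Fin d) → ℝ)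
    (p : VField d × VField d) (hp : p ∈ lameGraph lam mu V) (h0 : p.1 = 0) : p.2 = 0 := by
  obtain ⟨-, h2, h3⟩ := hp
  have h4 : p.2 ∈ (formDomain V)ᗮ := by
    rw [Submodule.mem_orthogonal]
    intro v hv
    rw [← h3 v hv, h0, lameForm_zero_right]
  rw [← Submodule.orthogonal_closure] at h4
  have h5 := (Submodule.mem_orthogonal _ _).1 h4 p.2 h2
  exact inner_self_eq_zero.1 h5

/-- The perturbed Lamé operator `-Δ* + V` on `[L²(ℝᵈ)]ᵈ`, where
`Δ* u = mu Δ u + (lam + mu) ∇ div u`, defined through its quadratic form. -/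
def lameOperator {d : ℕ} (lam mu : ℝ) (V : EuclideanSpace ℝ (Fin d) → ℝ) :
    VField d →ₗ.[ℂ] VField d :=
  (lameGraph lam mu V).toLinearPMap

theorem lameOperator_graph {d : ℕ} (lam mu : ℝ) (V : EuclideanSpace ℝ (Fin d) → ℝ) :
    (lameOperator lam mu V).graph = lameGraph lam mu V :=
  Submodule.toLinearPMap_graph_eq _ (lameGraph_functional lam mu V)

/-- `z` is an eigenvalue of the (unbounded) operator `T`. -/
def IsEigenvalue {H : Type*} [AddCommGroup H] [Module ℂ H] (T : H →ₗ.[ℂ] H) (z : ℂ) : Prop :=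
  ∃ u : T.domain, (u : H) ≠ 0 ∧ T u = z • (u : H)

end Lame

end

/-! Let `u` be an eigenfunction for `z < 0`, and put `n = ‖u‖²`, `G = ∑ⱼ ‖∂ⱼ u‖²`, `p = γ + d/2`.
Testing the form equation with `v = u` makes the kinetic energy plus `|z| n` equal to `-∫ V|u|²`,
which is at most `∫ V₋|u|²`. Since `‖div u‖² ≤ G` (`integral_weakDiv_sq_le`), the kinetic energy is
at least `c G` with `c = min μ (λ + 2μ)`, whatever the sign of `λ + μ`. This gives `c G + |z| n ≤ ∫
V₋|u|²` (`kinetic_add_le_of_mem_lameGraph`).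

In the other direction a weighted Gagliardo–Nirenberg inequality gives `∫ V₋|u|² ≤ K ‖V₋‖_p n^(γ/p)
G^(d/(2p))` (`exists_integral_weightedBound`). The two exponents sum to `1`, so `n` and `G` cancel
between the two bounds (`rpow_le_of_le_mul_rpow`). What remains is `|z|^(γ/p) ≤ K ‖V₋‖_p
c^(-d/(2p))`, and the `p`-th power of this is the claim.

The weighted inequality is Hölder combined with an estimate depending on the dimension: a sup bound
for `d = 1`, Ladyzhenskaya's inequality for `d = 2`, Sobolev's for `d ≥ 3`. It is proved for
compactly supported `C¹` functions and carried to `H¹` by density and Fatou. Both the density and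
the bound on the divergence rest on writing `H¹` functions as Bessel potentials of `L²` functions
(`IsWeakGrad.exists_potential`). -/

noncomputable section

namespace Lame

open TemperedDistribution FourierTransform
open scoped ENNReal NNReal

/-! ### Bounded Fourier multipliers on `L²`. -/

section Multiplier

variable {E : Type*} [NormedAddCommGroup E] [InnerProductSpace ℝ E] [FiniteDimensional ℝ E]
  [MeasurableSpace E] [BorelSpace E]

/-- The Fourier multiplier on `L²` with symbol `m ∈ L^∞`. -/
def l2Multiplier (m : Lp ℂ ∞ (volume : Measure E)) :
    Lp ℂ 2 (volume : Measure E) →L[ℂ] Lp ℂ 2 (volume : Measure E) :=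
  ((Lp.fourierTransformₗᵢ E ℂ).symm.toContinuousLinearEquiv :
      Lp ℂ 2 (volume : Measure E) →L[ℂ] Lp ℂ 2 (volume : Measure E)) ∘L
    ((ContinuousLinearMap.mul ℂ ℂ).holderL volume ∞ 2 2 m) ∘L
    ((Lp.fourierTransformₗᵢ E ℂ).toContinuousLinearEquiv :
      Lp ℂ 2 (volume : Measure E) →L[ℂ] Lp ℂ 2 (volume : Measure E))

theorem l2Multiplier_apply (m : Lp ℂ ∞ (volume : Measure E)) (f : Lp ℂ 2 (volume : Measure E)) :
    l2Multiplier m f = 𝓕⁻ ((m • (𝓕 f) : Lp ℂ 2 (volume : Measure E))) := by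
  have h : (ContinuousLinearMap.mul ℂ ℂ).holder 2 m (𝓕 f)
      = (m • (𝓕 f) : Lp ℂ 2 (volume : Measure E)) := by
    refine Lp.ext ?_
    filter_upwards [ContinuousLinearMap.coeFn_holder (r := 2) (ContinuousLinearMap.mul ℂ ℂ) m (𝓕 f),
      Lp.coeFn_lpSMul (r := 2) m (𝓕 f)] with x h1 h2
    rw [h1, h2]
    simp
  rw [← h]
  rfl

theorem toTemperedDistribution_injective :
    Function.Injective (Lp.toTemperedDistribution : Lp ℂ 2 (volume : Measure E) → 𝓢'(E, ℂ)) :=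
  LinearMap.ker_eq_bot.1
    (Lp.ker_toTemperedDistributionCLM_eq_bot (F := ℂ) (μ := (volume : Measure E)) (p := 2))

/-- Bridge between the `L²` and the distributional calculus: with
`toTemperedDistribution_injective`, identities between distributions become identities in `L²`. -/
theorem toTemperedDistribution_l2Multiplier {g : E → ℂ} (hg : g.HasTemperateGrowth)
    (hg' : MemLp g ∞ (volume : Measure E)) (f : Lp ℂ 2 (volume : Measure E)) :
    Lp.toTemperedDistribution (l2Multiplier (hg'.toLp g) f)
      = fourierMultiplierCLM ℂ g (Lp.toTemperedDistribution f) := by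
  rw [l2Multiplier_apply, ← Lp.fourierInv_toTemperedDistribution_eq,
    Lp.toTemperedDistribution_smul_eq hg, ← Lp.fourier_toTemperedDistribution_eq,
    fourierMultiplierCLM_apply]

theorem memLp_top_of_temperate {g : E → ℂ} (hg : g.HasTemperateGrowth) {C : ℝ}
    (hC : ∀ x, ‖g x‖ ≤ C) : MemLp g ∞ (volume : Measure E) :=
  memLp_top_of_bound hg.1.continuous.aestronglyMeasurable C (.of_forall hC)

/-- By Plancherel both sides are the integral of `m₁ m₂` against the same product of transforms.
Realness matters: conjugation in the first slot leaves the symbols unchanged. -/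
theorem inner_l2Multiplier_comm {m₁ m₂ : E → ℝ}
    (h₁ : MemLp (fun x => (m₁ x : ℂ)) ∞ (volume : Measure E))
    (h₂ : MemLp (fun x => (m₂ x : ℂ)) ∞ (volume : Measure E))
    (f g : Lp ℂ 2 (volume : Measure E)) :
    inner ℂ (l2Multiplier h₁.toLp f) (l2Multiplier h₂.toLp g)
      = inner ℂ (l2Multiplier h₂.toLp f) (l2Multiplier h₁.toLp g) := by
  rw [← Lp.inner_fourier_eq, ← Lp.inner_fourier_eq (l2Multiplier h₂.toLp f)]
  simp only [l2Multiplier_apply, fourier_fourierInv_eq]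
  simp only [L2.inner_def]
  refine integral_congr_ae ?_
  filter_upwards [h₁.coeFn_toLp, h₂.coeFn_toLp,
    Lp.coeFn_lpSMul (r := 2) h₁.toLp (𝓕 f), Lp.coeFn_lpSMul (r := 2) h₂.toLp (𝓕 f),
    Lp.coeFn_lpSMul (r := 2) h₁.toLp (𝓕 g), Lp.coeFn_lpSMul (r := 2) h₂.toLp (𝓕 g)]
    with x e1 e2 e3 e4 e5 e6
  simp only [e3, e4, e5, e6, Pi.smul_apply', e1, e2, smul_eq_mul, RCLike.inner_apply, map_mul,
    Complex.conj_ofReal]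
  ring

end Multiplier

/-! ### Weak gradients, Bessel potentials and density of Schwartz functions in `H¹`. -/

section Scalar

variable {d : ℕ}

/-- The space `L²(ℝᵈ)` of scalar functions. -/
abbrev Scalar (d : ℕ) : Type := Lp ℂ 2 (volume : Measure (EuclideanSpace ℝ (Fin d)))

/-- `g` is the weak gradient of the scalar function `u`. -/
def IsWeakGrad (u : Scalar d) (g : Fin d → Scalar d) : Prop :=
  ∀ j, ∂_{(EuclideanSpace.single j (1 : ℝ) : EuclideanSpace ℝ (Fin d))}
    (Lp.toTemperedDistribution u) = Lp.toTemperedDistribution (g j)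

/-- The `i`-th component of a vector field. -/
def component (i : Fin d) : VField d →L[ℂ] Scalar d :=
  (EuclideanSpace.proj (𝕜 := ℂ) i : EuclideanSpace ℂ (Fin d) →L[ℂ] ℂ).compLpL 2 volume

theorem coeFn_component (i : Fin d) (u : VField d) :
    component i u =ᵐ[volume] fun x => u x i :=
  ContinuousLinearMap.coeFn_compLpL _ u

theorem toTemperedDistribution_component (i : Fin d) (u : VField d)
    (φ : 𝓢(EuclideanSpace ℝ (Fin d), ℂ)) :
    Lp.toTemperedDistribution (component i u) φ = Lp.toTemperedDistribution u φ i := by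
  rw [Lp.toTemperedDistribution_apply, Lp.toTemperedDistribution_apply]
  have hint : Integrable (fun x => φ x • u x) volume := by
    have h := MemLp.smul (p := 2) (q := 2) (r := 1) (Lp.memLp u) (φ.memLp 2 volume)
    exact memLp_one_iff_integrable.1 h
  have h := (EuclideanSpace.proj (𝕜 := ℂ) i : EuclideanSpace ℂ (Fin d) →L[ℂ] ℂ).integral_comp_comm
    hint
  refine Eq.trans (integral_congr_ae ?_) h
  filter_upwards [coeFn_component i u] with x hx
  simp [hx]

theorem isWeakGrad_component {u : VField d} (hu : u ∈ H1 d) (i : Fin d) :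
    IsWeakGrad (component i u) (fun j => component i (weakPartial j u)) := by
  intro j
  ext φ
  have h := congrArg (fun T : 𝓢'(EuclideanSpace ℝ (Fin d), EuclideanSpace ℂ (Fin d)) => T φ i)
    (weakPartial_spec hu j)
  simp only [lineDerivOp_apply_apply] at h
  rw [lineDerivOp_apply_apply, toTemperedDistribution_component, toTemperedDistribution_component]
  simpa using h

/-- The symbol of the Bessel potential of order `-1`. -/
def besselSymbol (x : EuclideanSpace ℝ (Fin d)) : ℝ := (1 + ‖x‖ ^ 2) ^ (-1 / 2 : ℝ)

theorem besselSymbol_sq (x : EuclideanSpace ℝ (Fin d)) :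
    besselSymbol x ^ 2 = (1 + ‖x‖ ^ 2)⁻¹ := by
  rw [besselSymbol, ← Real.rpow_mul_natCast (by positivity), ← Real.rpow_neg_one]
  norm_num

/-- The symbol of `(2πi)⁻¹ ∂ⱼ` composed with the Bessel potential of order `-1`. -/
def rieszSymbol (j : Fin d) (x : EuclideanSpace ℝ (Fin d)) : ℝ :=
  inner ℝ x (EuclideanSpace.single j (1 : ℝ)) * besselSymbol x

theorem hasTemperateGrowth_besselSymbol :
    (fun x : EuclideanSpace ℝ (Fin d) => (besselSymbol x : ℂ)).HasTemperateGrowth := by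
  unfold besselSymbol; fun_prop

theorem hasTemperateGrowth_rieszSymbol (j : Fin d) :
    (fun x : EuclideanSpace ℝ (Fin d) => (rieszSymbol j x : ℂ)).HasTemperateGrowth := by
  unfold rieszSymbol besselSymbol; fun_prop

theorem memLp_besselSymbol :
    MemLp (fun x : EuclideanSpace ℝ (Fin d) => (besselSymbol x : ℂ)) ∞ volume := by
  refine memLp_top_of_temperate hasTemperateGrowth_besselSymbol (C := 1) fun x => ?_
  rw [Complex.norm_real, Real.norm_eq_abs, ← sq_le_one_iff_abs_le_one, besselSymbol_sq]
  exact inv_le_one_of_one_le₀ (by nlinarith [sq_nonneg ‖x‖])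

theorem memLp_rieszSymbol (j : Fin d) :
    MemLp (fun x : EuclideanSpace ℝ (Fin d) => (rieszSymbol j x : ℂ)) ∞ volume := by
  refine memLp_top_of_temperate (hasTemperateGrowth_rieszSymbol j) (C := 1) fun x => ?_
  rw [Complex.norm_real, Real.norm_eq_abs, ← sq_le_one_iff_abs_le_one, rieszSymbol, mul_pow,
    besselSymbol_sq, ← div_eq_mul_inv, div_le_one (by positivity)]
  have h := abs_real_inner_le_norm x (EuclideanSpace.single j (1 : ℝ))
  simp only [PiLp.norm_single, norm_one, mul_one] at h
  nlinarith [sq_abs (inner ℝ x (EuclideanSpace.single j (1 : ℝ))),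
    abs_nonneg (inner ℝ x (EuclideanSpace.single j (1 : ℝ))), norm_nonneg x]

theorem toTemperedDistribution_bessel (f : Scalar d) :
    Lp.toTemperedDistribution (l2Multiplier memLp_besselSymbol.toLp f)
      = besselPotential _ ℂ (-1) (Lp.toTemperedDistribution f) :=
  toTemperedDistribution_l2Multiplier hasTemperateGrowth_besselSymbol _ f

/-- The factor `2πi` in the symbol of `∂ⱼ` stays outside the multiplier, so that the remaining
symbol is real and `inner_l2Multiplier_comm` applies. -/
theorem toTemperedDistribution_riesz (j : Fin d) (f : Scalar d) :
    Lp.toTemperedDistribution ((2 * Real.pi * Complex.I) • l2Multiplier (memLp_rieszSymbol j).toLp f)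
      = ∂_{(EuclideanSpace.single j (1 : ℝ) : EuclideanSpace ℝ (Fin d))}
          (besselPotential _ ℂ (-1) (Lp.toTemperedDistribution f)) := by
  rw [← Lp.toTemperedDistributionCLM_apply, map_smul, Lp.toTemperedDistributionCLM_apply,
    toTemperedDistribution_l2Multiplier (hasTemperateGrowth_rieszSymbol j),
    lineDeriv_eq_fourierMultiplierCLM, besselPotential,
    fourierMultiplierCLM_fourierMultiplierCLM_apply (by fun_prop) (by fun_prop)]
  congr 3
  ext x
  simp [rieszSymbol, besselSymbol, mul_comm]

/-- Elliptic regularity: `∂ⱼ u ∈ L²` puts `Δu` in `H⁻¹`, hence the order-2 Bessel operator sends `u`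
into `H⁻¹`, which means `u ∈ H¹`. The function `f` is the order-1 Bessel operator applied to `u`. -/
theorem IsWeakGrad.exists_potential {u : Scalar d} {g : Fin d → Scalar d} (h : IsWeakGrad u g) :
    ∃ f : Scalar d, u = l2Multiplier memLp_besselSymbol.toLp f ∧
      ∀ j, g j = (2 * Real.pi * Complex.I) • l2Multiplier (memLp_rieszSymbol j).toLp f := by
  have h0 : MemSobolev 1 2 (Lp.toTemperedDistribution u) := by
    have hu : MemSobolev (-1) 2 (Lp.toTemperedDistribution u) :=
      MemSobolev.mono (by norm_num : (-1 : ℝ) ≤ 0) (memSobolev_zero_iff.2 ⟨u, rfl⟩)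
    have hg : ∀ j, MemSobolev (-1) 2 (∂_{(EuclideanSpace.single j (1 : ℝ) : EuclideanSpace ℝ (Fin d))}
        (∂_{(EuclideanSpace.single j (1 : ℝ) : EuclideanSpace ℝ (Fin d))}
          (Lp.toTemperedDistribution u))) := fun j => by
      rw [h j]
      have := (memSobolev_zero_iff.2 ⟨g j, rfl⟩ :
        MemSobolev 0 2 (Lp.toTemperedDistribution (g j))).lineDerivOp
          (m := (EuclideanSpace.single j (1 : ℝ) : EuclideanSpace ℝ (Fin d)))
      rwa [zero_sub] at this
    have hlap : MemSobolev (-1) 2 (Laplacian.laplacian (Lp.toTemperedDistribution u)) := by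
      rw [laplacian_eq_sum (EuclideanSpace.basisFun (Fin d) ℝ)]
      simp only [EuclideanSpace.basisFun_apply]
      refine Finset.sum_induction _ (MemSobolev (-1) 2) (fun a b => MemSobolev.add) ?_ fun j _ => hg j
      exact memSobolev_fun_zero _ _ _ _
    -- In this normalisation `Δ` has symbol `-(2π)²|x|²`, so `1 + |x|²` is the symbol of `1 - (2π)⁻²
    -- Δ`.
    have hb : besselPotential _ ℂ 2 (Lp.toTemperedDistribution u)
        = Lp.toTemperedDistribution u
          + (-(((2 * Real.pi) ^ 2)⁻¹ : ℝ) : ℂ) • Laplacian.laplacian (Lp.toTemperedDistribution u) := by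
      rw [laplacian_eq_fourierMultiplierCLM, besselPotential]
      have hs : (fun x : EuclideanSpace ℝ (Fin d) => (((1 + ‖x‖ ^ 2) ^ ((2 : ℝ) / 2) : ℝ) : ℂ))
          = fun x => ∑ i : Bool, (bif i then fun _ => (1 : ℂ)
              else fun x : EuclideanSpace ℝ (Fin d) => ((‖x‖ ^ 2 : ℝ) : ℂ)) x := by
        ext x; simp
      rw [hs, fourierMultiplierCLM_sum]
      · simp only [Fintype.sum_bool, cond_true, cond_false, fourierMultiplierCLM_const, one_smul]
        rw [add_apply, ContinuousLinearMap.id_apply, ← Complex.coe_smul,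
          smul_smul]
        congr 1
        have : (-(((2 * Real.pi) ^ 2)⁻¹ : ℝ) : ℂ) * ((-(2 * Real.pi) ^ 2 : ℝ) : ℂ) = 1 := by
          rw [← Complex.ofReal_neg, ← Complex.ofReal_mul]
          norm_cast
          field_simp
        rw [this, one_smul]
      · intro i _
        cases i <;> simp only [cond_true, cond_false] <;> fun_prop
    have : MemSobolev (-1) 2 (besselPotential _ ℂ 2 (Lp.toTemperedDistribution u)) := by
      rw [hb]
      exact hu.add (hlap.smul _)
    rw [memSobolev_besselPotential_iff] at this
    norm_num at this
    exact this
  obtain ⟨f, hf⟩ := h0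
  have hu : Lp.toTemperedDistribution u = besselPotential _ ℂ (-1) (Lp.toTemperedDistribution f) := by
    rw [← hf]; simp
  refine ⟨f, toTemperedDistribution_injective ?_, fun j => toTemperedDistribution_injective ?_⟩
  · rw [toTemperedDistribution_bessel, hu]
  · rw [toTemperedDistribution_riesz, ← hu, h j]

/-- Mixed second derivatives commute, in the weak form `⟨∂ⱼ u, ∂ₖ w⟩ = ⟨∂ₖ u, ∂ⱼ w⟩`. -/
theorem IsWeakGrad.inner_comm {u w : Scalar d} {g h : Fin d → Scalar d} (hu : IsWeakGrad u g)
    (hw : IsWeakGrad w h) (j k : Fin d) : inner ℂ (g j) (h k) = inner ℂ (g k) (h j) := by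
  obtain ⟨a, -, ha⟩ := hu.exists_potential
  obtain ⟨b, -, hb⟩ := hw.exists_potential
  rw [ha, ha, hb, hb]
  simp only [inner_smul_left, inner_smul_right]
  -- With both functions written as potentials, the identity only exchanges two real multipliers.
  rw [inner_l2Multiplier_comm]

/-- Schwartz functions are dense in `H¹`. -/
theorem IsWeakGrad.exists_schwartz_tendsto {u : Scalar d} {g : Fin d → Scalar d}
    (h : IsWeakGrad u g) :
    ∃ φ : ℕ → 𝓢(EuclideanSpace ℝ (Fin d), ℂ),
      Filter.Tendsto (fun n => (φ n).toLp 2 volume) Filter.atTop (nhds u) ∧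
      ∀ j, Filter.Tendsto
        (fun n => (∂_{(EuclideanSpace.single j (1 : ℝ) : EuclideanSpace ℝ (Fin d))} (φ n)).toLp 2
          volume) Filter.atTop (nhds (g j)) := by
  obtain ⟨f, hu, hg⟩ := h.exists_potential
  have hd : DenseRange (SchwartzMap.toLpCLM ℝ ℂ 2 (volume : Measure (EuclideanSpace ℝ (Fin d)))) :=
    SchwartzMap.denseRange_toLpCLM ENNReal.ofNat_ne_top
  obtain ⟨s, hs, hs'⟩ := mem_closure_iff_seq_limit.1 (hd f)
  choose ψ hψ using hs
  have hψ' : ∀ n, (ψ n).toLp 2 volume = s n := hψ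
  -- Approximating the potential `f` in `L²` is enough: the Bessel multiplier keeps `ψ n` Schwartz,
  -- and `L²`-boundedness of the two multipliers gives convergence of `φ n` and of its derivatives.
  set φ := fun n => SchwartzMap.fourierMultiplierCLM ℂ (fun x => (besselSymbol x : ℂ)) (ψ n) with hφ
  have h1 : ∀ n, ((φ n : 𝓢'(EuclideanSpace ℝ (Fin d), ℂ)))
      = besselPotential _ ℂ (-1) (Lp.toTemperedDistribution ((ψ n).toLp 2 volume)) := fun n => by
    rw [Lp.toTemperedDistribution_toLp_eq]
    exact (fourierMultiplierCLM_toTemperedDistributionCLM_eq hasTemperateGrowth_besselSymbol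
      (ψ n)).symm
  refine ⟨φ, ?_, fun j => ?_⟩
  · have : ∀ n, (φ n).toLp 2 volume = l2Multiplier memLp_besselSymbol.toLp (s n) := fun n => by
      refine toTemperedDistribution_injective ?_
      rw [toTemperedDistribution_bessel, ← hψ', ← h1, Lp.toTemperedDistribution_toLp_eq]
    simp only [this, hu]
    exact ((l2Multiplier _).continuous.tendsto f).comp hs'
  · have : ∀ n, (∂_{(EuclideanSpace.single j (1 : ℝ) : EuclideanSpace ℝ (Fin d))} (φ n)).toLp 2 volume
        = (2 * Real.pi * Complex.I) • l2Multiplier (memLp_rieszSymbol j).toLp (s n) := fun n => by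
      refine toTemperedDistribution_injective ?_
      rw [toTemperedDistribution_riesz, ← hψ', ← h1, Lp.toTemperedDistribution_toLp_eq,
        lineDerivOp_toTemperedDistributionCLM_eq]
    simp only [this, hg]
    exact (((l2Multiplier _).continuous.tendsto f).comp hs').const_smul _

end Scalar

/-! ### Weighted Gagliardo–Nirenberg inequality for compactly supported `C¹` functions. -/

section GagliardoNirenberg

/-- Hölder for the three functions `W ^ p`, `f ^ 2`, `f ^ r` with exponents `1 / p`, `α`, `β`; `h2`
makes the powers of `f` add up to `2`. -/
theorem lintegral_mul_sq_le_of_interpolation {X : Type*} [MeasurableSpace X] {ν : Measure X}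
    {W f : X → ℝ≥0∞} (hW : AEMeasurable W ν) (hf : AEMeasurable f ν) {p r α β : ℝ} (hp : 0 < p)
    (hr : 0 ≤ r) (hα : 0 ≤ α) (hβ : 0 ≤ β) (h1 : 1 / p + α + β = 1) (h2 : 2 * α + r * β = 2) :
    ∫⁻ x, W x * f x ^ 2 ∂ν ≤
      (∫⁻ x, W x ^ p ∂ν) ^ (1 / p) * (∫⁻ x, f x ^ 2 ∂ν) ^ α * (∫⁻ x, f x ^ r ∂ν) ^ β := by
  have h := ENNReal.lintegral_prod_norm_pow_le (μ := ν) (Finset.univ : Finset (Fin 3))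
    (f := ![fun x => W x ^ p, fun x => f x ^ 2, fun x => f x ^ r]) (p := ![1 / p, α, β])
    (by
      intro i _
      fin_cases i
      · exact hW.pow_const _
      · exact hf.pow_const _
      · exact hf.pow_const _)
    (by simpa [Fin.sum_univ_three] using h1)
    (by
      intro i _
      fin_cases i
      · simpa using hp.le
      · exact hα
      · exact hβ)
  simp only [Fin.prod_univ_three, Matrix.cons_val_zero, Matrix.cons_val_one, Matrix.cons_val] at h
  refine le_trans (le_of_eq (lintegral_congr fun x => ?_)) h
  rw [← ENNReal.rpow_mul, mul_one_div_cancel hp.ne', ENNReal.rpow_one, mul_assoc]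
  congr 1
  rw [← ENNReal.rpow_natCast, ← ENNReal.rpow_mul, ← ENNReal.rpow_mul,
    ← ENNReal.rpow_add_of_nonneg _ _ (by positivity) (by positivity)]
  push_cast
  rw [h2]

/-- The share `1 / p` of `f ^ 2` is bounded by the supremum, and Hölder pairs `W` with the remaining
share `1 - 1 / p`, which is nonnegative because `1 ≤ p`. -/
theorem lintegral_mul_sq_le_of_le_sup {X : Type*} [MeasurableSpace X] {ν : Measure X}
    {W f : X → ℝ≥0∞} (hW : AEMeasurable W ν) (hf : AEMeasurable f ν) {p : ℝ} (hp : 1 ≤ p)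
    {S : ℝ≥0∞} (hS : ∀ x, f x ^ 2 ≤ S) :
    ∫⁻ x, W x * f x ^ 2 ∂ν ≤
      S ^ (1 / p) * ((∫⁻ x, W x ^ p ∂ν) ^ (1 / p) * (∫⁻ x, f x ^ 2 ∂ν) ^ (1 - 1 / p)) := by
  have hp0 : 0 < p := by linarith
  have hp1 : 1 / p ≤ 1 := by rw [div_le_one hp0]; exact hp
  refine le_trans ?_ (mul_le_mul_right (ENNReal.lintegral_mul_norm_pow_le (hW.pow_const p)
    (hf.pow_const 2) (by positivity : 0 ≤ 1 / p) (by linarith : 0 ≤ 1 - 1 / p) (by ring)) _)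
  rw [← lintegral_const_mul'' _ (by fun_prop)]
  refine lintegral_mono fun x => ?_
  calc W x * f x ^ 2 = (f x ^ 2) ^ (1 / p) * (W x * (f x ^ 2) ^ (1 - 1 / p)) := by
        rw [mul_left_comm, ← ENNReal.rpow_add_of_nonneg _ _ (by positivity) (by linarith)]
        simp
    _ ≤ S ^ (1 / p) * (W x * (f x ^ 2) ^ (1 - 1 / p)) := by
        gcongr
        exact hS x
    _ = _ := by rw [← ENNReal.rpow_mul, mul_one_div_cancel hp0.ne', ENNReal.rpow_one]

variable {d : ℕ}

theorem enorm_fderiv_pow_le {E : Type*} [NormedAddCommGroup E] [NormedSpace ℝ E] {u : E → ℂ}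
    (hu : Differentiable ℝ u) (k : ℕ) (x : E) :
    ‖fderiv ℝ (fun y => u y ^ (k + 1)) x‖ₑ ≤ (k + 1 : ℝ≥0∞) * (‖u x‖ₑ ^ k * ‖fderiv ℝ u x‖ₑ) := by
  have h : fderiv ℝ (fun y => u y ^ (k + 1)) x = (((k + 1 : ℕ) : ℂ) * u x ^ k) • fderiv ℝ u x := by
    have := ((hu x).hasFDerivAt.pow (k + 1)).fderiv
    simpa [nsmul_eq_mul] using this
  rw [h, enorm_smul, enorm_mul, enorm_pow, mul_assoc]
  refine mul_le_mul_left (le_of_eq ?_) _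
  rw [← ofReal_norm, Complex.norm_natCast, ENNReal.ofReal_natCast]
  push_cast
  rfl

theorem sq_lintegral_mul_le {X : Type*} [MeasurableSpace X] {ν : Measure X}
    {f g : X → ℝ≥0∞} (hf : AEMeasurable f ν) (hg : AEMeasurable g ν) :
    (∫⁻ x, f x * g x ∂ν) ^ 2 ≤ (∫⁻ x, f x ^ 2 ∂ν) * ∫⁻ x, g x ^ 2 ∂ν := by
  have h := ENNReal.lintegral_mul_norm_pow_le (hf.pow_const 2) (hg.pow_const 2)
    (by norm_num : (0 : ℝ) ≤ 1 / 2) (by norm_num : (0 : ℝ) ≤ 1 / 2) (by norm_num)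
  have hs : ∀ a : ℝ≥0∞, (a ^ 2) ^ (1 / 2 : ℝ) = a := fun a => by
    rw [← ENNReal.rpow_natCast, ← ENNReal.rpow_mul]; norm_num
  have hs' : ∀ a : ℝ≥0∞, (a ^ (1 / 2 : ℝ)) ^ 2 = a := fun a => by
    rw [← ENNReal.rpow_natCast, ← ENNReal.rpow_mul]; norm_num
  simp only [hs] at h
  calc _ ≤ _ := pow_le_pow_left' h 2
    _ = _ := by rw [mul_pow, hs', hs']

theorem measurable_enorm_fderiv {u : EuclideanSpace ℝ (Fin d) → ℂ} (hu : ContDiff ℝ 1 u) :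
    AEMeasurable (fun x => ‖fderiv ℝ u x‖ₑ) volume :=
  (hu.continuous_fderiv one_ne_zero).enorm.aemeasurable

theorem measurable_enorm_contDiff {u : EuclideanSpace ℝ (Fin d) → ℂ} (hu : ContDiff ℝ 1 u) :
    AEMeasurable (fun x => ‖u x‖ₑ) volume :=
  hu.continuous.enorm.aemeasurable

/-- Ladyzhenskaya's inequality in the plane, with an arbitrary even exponent. -/
theorem exists_ladyzhenskaya (k : ℕ) :
    ∃ C : ℝ≥0, ∀ u : EuclideanSpace ℝ (Fin 2) → ℂ, ContDiff ℝ 1 u → HasCompactSupport u →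
      ∫⁻ x, ‖u x‖ₑ ^ (2 * (k + 1)) ≤
        C * ((∫⁻ x, ‖u x‖ₑ ^ 2) * (∫⁻ x, ‖fderiv ℝ u x‖ₑ ^ 2) ^ k) := by
  induction k with
  | zero => exact ⟨1, fun u _ _ => by simp⟩
  | succ k ih =>
    obtain ⟨C, hC⟩ := ih
    refine ⟨lintegralPowLePowLIntegralFDerivConst
      (volume : Measure (EuclideanSpace ℝ (Fin 2))) 2 * (k + 1 + 1) ^ 2 * C, fun u hu hcu => ?_⟩
    have hp : Real.HolderConjugate (Module.finrank ℝ (EuclideanSpace ℝ (Fin 2))) 2 := by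
      rw [finrank_euclideanSpace_fin]
      exact_mod_cast Real.HolderConjugate.two_two
    have hcv : HasCompactSupport (fun x => u x ^ (k + 1 + 1)) :=
      hcu.comp_left (g := fun z : ℂ => z ^ (k + 1 + 1)) (by simp)
    -- The planar embedding of `W^{1,1}` into `L²` is applied to `u ^ (k + 2)`. Cauchy–Schwarz on
    -- `|u|^(k+1) |∇u|` then leaves the integral of `|u|^(2(k+1))`, which the induction hypothesis
    -- bounds.
    have h := lintegral_pow_le_pow_lintegral_fderiv volume (hu.pow (k + 1 + 1)) hcv hp
    have h2 : ∫⁻ x, ‖fderiv ℝ (fun y => u y ^ (k + 1 + 1)) x‖ₑ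
        ≤ (k + 1 + 1 : ℝ≥0∞) * ∫⁻ x, ‖u x‖ₑ ^ (k + 1) * ‖fderiv ℝ u x‖ₑ := by
      have hm := measurable_enorm_fderiv hu
      have hm' := measurable_enorm_contDiff hu
      rw [← lintegral_const_mul'' _ (by fun_prop)]
      refine lintegral_mono fun x => ?_
      simpa using enorm_fderiv_pow_le (hu.differentiable one_ne_zero) (k + 1) x
    have h3 := sq_lintegral_mul_le ((measurable_enorm_contDiff hu).pow_const (k + 1))
      (measurable_enorm_fderiv hu)
    set K := lintegralPowLePowLIntegralFDerivConst
      (volume : Measure (EuclideanSpace ℝ (Fin 2))) 2 with hK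
    calc ∫⁻ x, ‖u x‖ₑ ^ (2 * (k + 1 + 1))
        = ∫⁻ x, ‖u x ^ (k + 1 + 1)‖ₑ ^ (2 : ℝ) := lintegral_congr fun x => by
          rw [enorm_pow, ENNReal.rpow_ofNat, ← pow_mul, mul_comm]
      _ ≤ K * (∫⁻ x, ‖fderiv ℝ (fun y => u y ^ (k + 1 + 1)) x‖ₑ) ^ (2 : ℝ) := h
      _ ≤ K * ((k + 1 + 1 : ℝ≥0∞) * ∫⁻ x, ‖u x‖ₑ ^ (k + 1) * ‖fderiv ℝ u x‖ₑ) ^ 2 := by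
          rw [ENNReal.rpow_ofNat]; gcongr
      _ ≤ K * ((k + 1 + 1 : ℝ≥0∞) ^ 2 *
            ((∫⁻ x, (‖u x‖ₑ ^ (k + 1)) ^ 2) * ∫⁻ x, ‖fderiv ℝ u x‖ₑ ^ 2)) := by
          rw [mul_pow]; gcongr
      _ ≤ K * ((k + 1 + 1 : ℝ≥0∞) ^ 2 *
            ((C * ((∫⁻ x, ‖u x‖ₑ ^ 2) * (∫⁻ x, ‖fderiv ℝ u x‖ₑ ^ 2) ^ k)) *
              ∫⁻ x, ‖fderiv ℝ u x‖ₑ ^ 2)) := by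
          gcongr
          refine le_trans (le_of_eq (lintegral_congr fun x => ?_)) (hC u hu hcu)
          rw [← pow_mul, mul_comm]
      _ = _ := by
          push_cast
          ring

/-- The fundamental theorem of calculus, transported from `ℝ` by a measure-preserving linear
isometry. -/
theorem enorm_le_lintegral_enorm_fderiv {v : EuclideanSpace ℝ (Fin 1) → ℂ} (hv : ContDiff ℝ 1 v)
    (hcv : HasCompactSupport v) (x : EuclideanSpace ℝ (Fin 1)) :
    ‖v x‖ₑ ≤ ∫⁻ y, ‖fderiv ℝ v y‖ₑ := by
  let e : ℝ ≃ₗᵢ[ℝ] EuclideanSpace ℝ (Fin 1) := (OrthonormalBasis.singleton (Fin 1) ℝ).repr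
  have he : MeasurePreserving e := e.measurePreserving
  have hw : ContDiff ℝ 1 (v ∘ e) := hv.comp e.contDiff
  have hcw : HasCompactSupport (v ∘ e) := hcv.comp_homeomorph e.toHomeomorph
  calc ‖v x‖ₑ = ‖(v ∘ e) (e.symm x)‖ₑ := by simp
    _ ≤ ∫⁻ t in Set.Iic (e.symm x), ‖deriv (v ∘ e) t‖ₑ :=
        HasCompactSupport.enorm_le_lintegral_Ici_deriv hw hcw _
    _ ≤ ∫⁻ t, ‖deriv (v ∘ e) t‖ₑ := setLIntegral_le_lintegral _ _
    _ ≤ ∫⁻ t, ‖fderiv ℝ v (e t)‖ₑ := by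
        refine lintegral_mono fun t => ?_
        have h1 : HasDerivAt (v ∘ e) (fderiv ℝ v (e t) (e 1)) t := by
          have h2 := ((hv.differentiable one_ne_zero) (e t)).hasFDerivAt.comp t
            (e.toContinuousLinearEquiv : ℝ →L[ℝ] EuclideanSpace ℝ (Fin 1)).hasFDerivAt
          exact h2.hasDerivAt
        rw [h1.deriv]
        refine (ContinuousLinearMap.le_opENorm _ _).trans (le_of_eq ?_)
        rw [← ofReal_norm (e 1), e.norm_map]
        simp
    _ = ∫⁻ y, ‖fderiv ℝ v y‖ₑ :=
        he.lintegral_comp_emb e.toHomeomorph.measurableEmbedding (fun y => ‖fderiv ℝ v y‖ₑ)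

/-- The one-dimensional sup bound is applied to `u ^ 2`, whose derivative is `2 u u'`;
Cauchy–Schwarz splits the product. -/
theorem enorm_sq_le_of_dim_one {u : EuclideanSpace ℝ (Fin 1) → ℂ} (hu : ContDiff ℝ 1 u)
    (hcu : HasCompactSupport u) (x : EuclideanSpace ℝ (Fin 1)) :
    ‖u x‖ₑ ^ 2 ≤ 2 * ((∫⁻ x, ‖u x‖ₑ ^ 2) ^ (1 / 2 : ℝ) *
      (∫⁻ x, ‖fderiv ℝ u x‖ₑ ^ 2) ^ (1 / 2 : ℝ)) := by
  have hcv : HasCompactSupport (fun x => u x ^ (1 + 1)) :=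
    hcu.comp_left (g := fun z : ℂ => z ^ (1 + 1)) (by simp)
  have hm := measurable_enorm_fderiv hu
  have hm' := measurable_enorm_contDiff hu
  calc ‖u x‖ₑ ^ 2 = ‖u x ^ (1 + 1)‖ₑ := by rw [enorm_pow]
    _ ≤ ∫⁻ y, ‖fderiv ℝ (fun y => u y ^ (1 + 1)) y‖ₑ :=
        enorm_le_lintegral_enorm_fderiv (hu.pow _) hcv x
    _ ≤ ∫⁻ y, 2 * (‖u y‖ₑ * ‖fderiv ℝ u y‖ₑ) := by
        refine lintegral_mono fun y => ?_
        refine (enorm_fderiv_pow_le (hu.differentiable one_ne_zero) 1 y).trans (le_of_eq ?_)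
        norm_num
    _ = 2 * ∫⁻ y, ‖u y‖ₑ * ‖fderiv ℝ u y‖ₑ := lintegral_const_mul'' _ (by fun_prop)
    _ ≤ _ := by
        gcongr
        have h := ENNReal.lintegral_mul_norm_pow_le (hm'.pow_const 2) (hm.pow_const 2)
          (by norm_num : (0 : ℝ) ≤ 1 / 2) (by norm_num : (0 : ℝ) ≤ 1 / 2) (by norm_num)
        refine le_trans (le_of_eq (lintegral_congr fun y => ?_)) h
        have hs : ∀ a : ℝ≥0∞, (a ^ 2) ^ (1 / 2 : ℝ) = a := fun a => by
          rw [← ENNReal.rpow_natCast, ← ENNReal.rpow_mul]; norm_num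
        simp only [hs]

/-- The weighted Gagliardo–Nirenberg inequality for `u`, where `N = ∫ |u|²` and `D = ∫ |∇u|²`. -/
def WeightedBound (d : ℕ) (γ : ℝ) (C : ℝ≥0) (u : EuclideanSpace ℝ (Fin d) → ℂ)
    (N D : ℝ≥0∞) : Prop :=
  ∀ w : EuclideanSpace ℝ (Fin d) → ℝ, AEMeasurable w volume →
    ∫⁻ x, ‖w x‖ₑ ^ (γ + d / 2) ≠ ∞ →
    ∫⁻ x, ‖w x‖ₑ * ‖u x‖ₑ ^ 2 ≤ C * (∫⁻ x, ‖w x‖ₑ ^ (γ + d / 2)) ^ (1 / (γ + d / 2)) *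
      (N ^ (γ / (γ + d / 2)) * D ^ (d / 2 / (γ + d / 2)))

/-- Reduces the weighted inequality to an unweighted bound on `∫ |u|^r`. The equations `h3` and `h4`
say that the resulting powers of `N` and `D` are those of `WeightedBound`. -/
theorem weightedBound_of_interpolation {γ : ℝ} (hp : 0 < γ + d / 2) {C : ℝ≥0}
    {u : EuclideanSpace ℝ (Fin d) → ℂ} (hu : Continuous u) {N D : ℝ≥0∞}
    (hN : ∫⁻ x, ‖u x‖ₑ ^ 2 = N) {r a b α β : ℝ} (hr : 0 ≤ r) (hα : 0 ≤ α) (hβ : 0 ≤ β)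
    (ha : 0 ≤ a) (h1 : 1 / (γ + d / 2) + α + β = 1) (h2 : 2 * α + r * β = 2)
    (h3 : α + a * β = γ / (γ + d / 2)) (h4 : b * β = d / 2 / (γ + d / 2))
    (h : ∫⁻ x, ‖u x‖ₑ ^ r ≤ C * (N ^ a * D ^ b)) :
    WeightedBound d γ (C ^ β) u N D := by
  intro W hW _
  refine (lintegral_mul_sq_le_of_interpolation hW.enorm hu.enorm.aemeasurable hp hr hα hβ h1 h2).trans ?_
  rw [hN]
  calc _ ≤ (∫⁻ x, ‖W x‖ₑ ^ (γ + d / 2)) ^ (1 / (γ + d / 2)) * N ^ α * (C * (N ^ a * D ^ b)) ^ β := by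
        gcongr
    _ = _ := by
        rw [ENNReal.mul_rpow_of_nonneg _ _ hβ, ENNReal.mul_rpow_of_nonneg _ _ hβ,
          ← ENNReal.rpow_mul, ← ENNReal.rpow_mul, h4, ← h3,
          ENNReal.rpow_add_of_nonneg _ _ hα (by positivity), ENNReal.coe_rpow_of_nonneg _ hβ]
        ring

theorem exists_weightedBound_three {γ : ℝ} (hd : 3 ≤ d) (hγ : 0 ≤ γ) :
    ∃ C : ℝ≥0, ∀ u : EuclideanSpace ℝ (Fin d) → ℂ, ContDiff ℝ 1 u → HasCompactSupport u →
      WeightedBound d γ C u (∫⁻ x, ‖u x‖ₑ ^ 2) (∫⁻ x, ‖fderiv ℝ u x‖ₑ ^ 2) := by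
  have hd' : (3 : ℝ) ≤ d := by exact_mod_cast hd
  have hp : 0 < γ + (d : ℝ) / 2 := by positivity
  -- The critical Sobolev exponent: `∫ |u|^r` is controlled by `D` alone, hence `a = 0` and `b = r /
  -- 2` below.
  set r : ℝ≥0 := ⟨2 * d / (d - 2), div_nonneg (by positivity) (by linarith)⟩ with hr
  have hr' : (r : ℝ) = 2 * d / (d - 2) := rfl
  have hd2 : (d : ℝ) - 2 ≠ 0 := by linarith
  have hd0 : (d : ℝ) ≠ 0 := by positivity
  have hr0 : (0 : ℝ) < r := by rw [hr']; exact div_pos (by positivity) (by linarith)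
  set K := eLpNormLESNormFDerivOfEqInnerConst
    (volume : Measure (EuclideanSpace ℝ (Fin d))) (2 : ℝ≥0) with hK
  refine ⟨(K ^ (r : ℝ)) ^ ((d - 2) / 2 / (γ + d / 2) : ℝ), fun u hu hcu => ?_⟩
  refine weightedBound_of_interpolation hp hu.continuous rfl (r := r) (a := 0) (b := d / (d - 2))
    (α := γ / (γ + d / 2)) hr0.le (by positivity)
    (div_nonneg (div_nonneg (by linarith) (by norm_num)) hp.le) le_rfl ?_ ?_ ?_ ?_ ?_
  · field_simp; ring
  · rw [hr']; field_simp
  · ring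
  · field_simp
  · have h := eLpNorm_le_eLpNorm_fderiv_of_eq_inner volume hu hcu (p := 2) (p' := r)
      (by norm_num) (by rw [finrank_euclideanSpace_fin]; omega)
      (by rw [finrank_euclideanSpace_fin, hr']; push_cast; field_simp)
    have h' := ENNReal.rpow_le_rpow h hr0.le
    rw [eLpNorm_nnreal_pow_eq_lintegral (by exact_mod_cast hr0.ne'),
      ENNReal.mul_rpow_of_nonneg _ _ hr0.le] at h'
    refine h'.trans (le_of_eq ?_)
    rw [ENNReal.coe_rpow_of_nonneg _ hr0.le, ENNReal.rpow_zero, one_mul]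
    congr 1
    rw [eLpNorm_eq_lintegral_rpow_enorm_toReal (by norm_num) (by norm_num), ← ENNReal.rpow_mul]
    simp only [ENNReal.coe_ofNat, ENNReal.toReal_ofNat, ENNReal.rpow_ofNat]
    congr 1
    rw [hr']; field_simp

theorem exists_weightedBound_two {γ : ℝ} (hγ : 0 < γ) :
    ∃ C : ℝ≥0, ∀ u : EuclideanSpace ℝ (Fin 2) → ℂ, ContDiff ℝ 1 u → HasCompactSupport u →
      WeightedBound 2 γ C u (∫⁻ x, ‖u x‖ₑ ^ 2) (∫⁻ x, ‖fderiv ℝ u x‖ₑ ^ 2) := by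
  -- The plane has no critical exponent, so a large even power `2 (k + 1)` is used; `1 < γ k` makes
  -- the Hölder exponent `α` nonnegative. Such a `k` exists only for `γ > 0`.
  obtain ⟨k, hk⟩ := exists_nat_gt (1 / γ)
  have hk0 : (0 : ℝ) < k := lt_trans (by positivity) hk
  have hk1 : 1 ≤ γ * k := by rw [div_lt_iff₀ hγ] at hk; linarith
  obtain ⟨C, hC⟩ := exists_ladyzhenskaya k
  refine ⟨C ^ (1 / ((γ + 1) * k) : ℝ), fun u hu hcu => ?_⟩
  refine weightedBound_of_interpolation (by positivity) hu.continuous rfl (r := 2 * (k + 1))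
    (a := 1) (b := k) (α := (γ * k - 1) / ((γ + 1) * k)) (by positivity)
    (div_nonneg (by linarith) (by positivity)) (by positivity) zero_le_one ?_ ?_ ?_ ?_ ?_
  · push_cast; field_simp; ring
  · field_simp; ring
  · push_cast; field_simp; ring
  · push_cast; field_simp
  · rw [ENNReal.rpow_one, ENNReal.rpow_natCast]
    refine le_trans (le_of_eq (lintegral_congr fun x => ?_)) (hC u hu hcu)
    rw [← ENNReal.rpow_natCast]
    push_cast
    rfl

/-- The threshold `1 / 2` is exactly the condition `1 ≤ γ + 1 / 2` on the Hölder exponent. The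
constant is the `2` of `enorm_sq_le_of_dim_one` raised to the power `1 / p`. -/
theorem exists_weightedBound_one {γ : ℝ} (hγ : 1 / 2 ≤ γ) :
    ∃ C : ℝ≥0, ∀ u : EuclideanSpace ℝ (Fin 1) → ℂ, ContDiff ℝ 1 u → HasCompactSupport u →
      WeightedBound 1 γ C u (∫⁻ x, ‖u x‖ₑ ^ 2) (∫⁻ x, ‖fderiv ℝ u x‖ₑ ^ 2) := by
  refine ⟨2 ^ (1 / (γ + (1 : ℕ) / 2) : ℝ), fun u hu hcu W hW _ => ?_⟩
  have hp : 1 ≤ γ + ((1 : ℕ) : ℝ) / 2 := by push_cast; linarith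
  have hp0 : 0 < γ + ((1 : ℕ) : ℝ) / 2 := by linarith
  refine (lintegral_mul_sq_le_of_le_sup hW.enorm (measurable_enorm_contDiff hu) hp
    (enorm_sq_le_of_dim_one hu hcu)).trans (le_of_eq ?_)
  have hq : 0 ≤ 1 / (γ + ((1 : ℕ) : ℝ) / 2) := by positivity
  have hq1 : 0 ≤ 1 - 1 / (γ + ((1 : ℕ) : ℝ) / 2) := by
    rw [sub_nonneg, div_le_one hp0]; exact hp
  have e1 : γ / (γ + ((1 : ℕ) : ℝ) / 2)
      = 1 / 2 * (1 / (γ + ((1 : ℕ) : ℝ) / 2)) + (1 - 1 / (γ + ((1 : ℕ) : ℝ) / 2)) := by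
    field_simp; push_cast; ring
  have e2 : ((1 : ℕ) : ℝ) / 2 / (γ + ((1 : ℕ) : ℝ) / 2)
      = 1 / 2 * (1 / (γ + ((1 : ℕ) : ℝ) / 2)) := by
    push_cast; ring
  rw [e1, e2, ENNReal.rpow_add_of_nonneg _ _ (by positivity) hq1,
    ENNReal.mul_rpow_of_nonneg _ _ hq, ENNReal.mul_rpow_of_nonneg _ _ hq, ENNReal.rpow_mul,
    ENNReal.rpow_mul, ENNReal.coe_rpow_of_nonneg _ hq]
  push_cast
  ring

theorem exists_weightedBound {γ : ℝ}
    (hγ : (d = 1 ∧ 1 / 2 ≤ γ) ∨ (d = 2 ∧ 0 < γ) ∨ (3 ≤ d ∧ 0 ≤ γ)) :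
    ∃ C : ℝ≥0, ∀ u : EuclideanSpace ℝ (Fin d) → ℂ, ContDiff ℝ 1 u → HasCompactSupport u →
      WeightedBound d γ C u (∫⁻ x, ‖u x‖ₑ ^ 2) (∫⁻ x, ‖fderiv ℝ u x‖ₑ ^ 2) := by
  rcases hγ with ⟨rfl, h⟩ | ⟨rfl, h⟩ | ⟨hd, h⟩
  · exact exists_weightedBound_one h
  · exact exists_weightedBound_two h
  · exact exists_weightedBound_three hd h

end GagliardoNirenberg

/-! ### Passage from `C¹` functions of compact support to `H¹`. -/

section Extension

variable {d : ℕ} {γ : ℝ} {C : ℝ≥0}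

theorem WeightedBound.mono (hγ : 0 ≤ γ) {u : EuclideanSpace ℝ (Fin d) → ℂ} {N N' D D' : ℝ≥0∞}
    (h : WeightedBound d γ C u N D) (hN : N ≤ N') (hD : D ≤ D') : WeightedBound d γ C u N' D' :=
  fun w hw hw' => (h w hw hw').trans (by gcongr)

/-- Fatou on the left, continuity in `N` and `D` on the right. Finiteness of the limits excludes `0
* ∞`, where multiplication is discontinuous. -/
theorem WeightedBound.of_tendsto (hγ : 0 ≤ γ) {v : ℕ → EuclideanSpace ℝ (Fin d) → ℂ}
    {u : EuclideanSpace ℝ (Fin d) → ℂ} {N' D' : ℕ → ℝ≥0∞} {N D : ℝ≥0∞}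
    (h : ∀ n, WeightedBound d γ C (v n) (N' n) (D' n))
    (hv : ∀ n, AEStronglyMeasurable (v n) volume)
    (hvu : ∀ᵐ x ∂volume, Filter.Tendsto (fun n => v n x) Filter.atTop (nhds (u x)))
    (hN : Filter.Tendsto N' Filter.atTop (nhds N)) (hD : Filter.Tendsto D' Filter.atTop (nhds D))
    (hN' : N ≠ ∞) (hD' : D ≠ ∞) : WeightedBound d γ C u N D := by
  intro w hw hw'
  have hs : 0 ≤ γ / (γ + d / 2) := by positivity
  have ht : 0 ≤ (d : ℝ) / 2 / (γ + d / 2) := by positivity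
  have hNs : N ^ (γ / (γ + d / 2)) ≠ ∞ := ENNReal.rpow_ne_top_of_nonneg hs hN'
  have hDt : D ^ ((d : ℝ) / 2 / (γ + d / 2)) ≠ ∞ := ENNReal.rpow_ne_top_of_nonneg ht hD'
  have hlim : Filter.Tendsto (fun n => C * (∫⁻ x, ‖w x‖ₑ ^ (γ + d / 2)) ^ (1 / (γ + d / 2)) *
      (N' n ^ (γ / (γ + d / 2)) * D' n ^ ((d : ℝ) / 2 / (γ + d / 2)))) Filter.atTop
      (nhds (C * (∫⁻ x, ‖w x‖ₑ ^ (γ + d / 2)) ^ (1 / (γ + d / 2)) *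
        (N ^ (γ / (γ + d / 2)) * D ^ ((d : ℝ) / 2 / (γ + d / 2))))) := by
    refine ENNReal.Tendsto.const_mul (ENNReal.Tendsto.mul ?_ (.inr hDt) ?_ (.inr hNs)) (.inr ?_)
    · exact (ENNReal.continuous_rpow_const.tendsto N).comp hN
    · exact (ENNReal.continuous_rpow_const.tendsto D).comp hD
    · exact ENNReal.mul_ne_top ENNReal.coe_ne_top
        (ENNReal.rpow_ne_top_of_nonneg (by positivity) hw')
  calc ∫⁻ x, ‖w x‖ₑ * ‖u x‖ₑ ^ 2
      ≤ ∫⁻ x, Filter.liminf (fun n => ‖w x‖ₑ * ‖v n x‖ₑ ^ 2) Filter.atTop := by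
        refine lintegral_mono_ae ?_
        filter_upwards [hvu] with x hx
        have : Filter.Tendsto (fun n => ‖w x‖ₑ * ‖v n x‖ₑ ^ 2) Filter.atTop
            (nhds (‖w x‖ₑ * ‖u x‖ₑ ^ 2)) :=
          ENNReal.Tendsto.const_mul (ENNReal.Tendsto.pow hx.enorm) (.inr enorm_ne_top)
        exact this.liminf_eq.ge
    _ ≤ Filter.liminf (fun n => ∫⁻ x, ‖w x‖ₑ * ‖v n x‖ₑ ^ 2) Filter.atTop :=
        lintegral_liminf_le' fun n => hw.enorm.mul ((hv n).enorm.pow_const 2)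
    _ ≤ Filter.liminf (fun n => C * (∫⁻ x, ‖w x‖ₑ ^ (γ + d / 2)) ^ (1 / (γ + d / 2)) *
          (N' n ^ (γ / (γ + d / 2)) * D' n ^ ((d : ℝ) / 2 / (γ + d / 2)))) Filter.atTop :=
        Filter.liminf_le_liminf (.of_forall fun n => h n w hw hw')
    _ = _ := hlim.liminf_eq

theorem lintegral_enorm_sq_eq {X F : Type*} [MeasurableSpace X] {ν : Measure X}
    [NormedAddCommGroup F] (f : X → F) : ∫⁻ x, ‖f x‖ₑ ^ 2 ∂ν = eLpNorm f 2 ν ^ 2 := by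
  have h := eLpNorm_nnreal_pow_eq_lintegral (f := f) (μ := ν) (p := 2) two_ne_zero
  simpa using h.symm

theorem lintegral_enorm_sq_eq_norm {X F : Type*} [MeasurableSpace X] {ν : Measure X}
    [NormedAddCommGroup F] (f : Lp F 2 ν) : ∫⁻ x, ‖f x‖ₑ ^ 2 ∂ν = ENNReal.ofReal (‖f‖ ^ 2) := by
  rw [lintegral_enorm_sq_eq, ← Lp.enorm_def, ← ofReal_norm, ENNReal.ofReal_pow (norm_nonneg _)]

theorem weightedBound_schwartz (hγ : 0 ≤ γ)
    (hC : ∀ u : EuclideanSpace ℝ (Fin d) → ℂ, ContDiff ℝ 1 u → HasCompactSupport u →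
      WeightedBound d γ C u (∫⁻ x, ‖u x‖ₑ ^ 2) (∫⁻ x, ‖fderiv ℝ u x‖ₑ ^ 2))
    (φ : 𝓢(EuclideanSpace ℝ (Fin d), ℂ)) :
    WeightedBound d γ C φ (∫⁻ x, ‖φ x‖ₑ ^ 2) (∫⁻ x, ‖fderiv ℝ φ x‖ₑ ^ 2) := by
  let χ : ContDiffBump (0 : EuclideanSpace ℝ (Fin d)) := ⟨1, 2, one_pos, one_lt_two⟩
  have hχ : ContDiff ℝ 1 χ := χ.contDiff
  obtain ⟨K, hK⟩ := (χ.hasCompactSupport.fderiv ℝ).exists_bound_of_continuous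
    (hχ.continuous_fderiv one_ne_zero)
  -- The cutoff `χ (c n • x)` is `1` on the ball of radius `n + 1` and has gradient at most `c n *
  -- K`, so truncation adds only a vanishing multiple of `|φ|` to the gradient.
  let c : ℕ → ℝ := fun n => 1 / ((n : ℝ) + 1)
  have hc : ∀ n, 0 < c n := fun n => by positivity
  have hc0 : Filter.Tendsto c Filter.atTop (nhds 0) := tendsto_one_div_add_atTop_nhds_zero_nat
  have hφ : ContDiff ℝ 1 φ := φ.smooth 1
  have hφ' : Differentiable ℝ φ := hφ.differentiable one_ne_zero
  have hφc : Continuous (fderiv ℝ φ) := hφ.continuous_fderiv one_ne_zero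
  let v : ℕ → EuclideanSpace ℝ (Fin d) → ℂ := fun n x => χ (c n • x) • φ x
  have hχn : ∀ n, ContDiff ℝ 1 (fun x : EuclideanSpace ℝ (Fin d) => χ (c n • x)) := fun n =>
    hχ.comp (contDiff_const_smul (c n))
  have hv : ∀ n, ContDiff ℝ 1 (v n) := fun n => (hχn n).smul hφ
  have hvc : ∀ n, HasCompactSupport (v n) := fun n =>
    (χ.hasCompactSupport.comp_smul (hc n).ne').smul_right
  have hχ1 : ∀ x, ‖χ x‖ₑ ≤ 1 := fun x => by
    rw [← ofReal_norm, Real.norm_of_nonneg χ.nonneg]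
    exact ENNReal.ofReal_le_one.2 χ.le_one
  have hder : ∀ n x, ‖fderiv ℝ (v n) x‖ₑ
      ≤ ‖fderiv ℝ φ x‖ₑ + ENNReal.ofReal (c n * K) * ‖φ x‖ₑ := fun n x => by
    have h1 : HasFDerivAt (fun x : EuclideanSpace ℝ (Fin d) => χ (c n • x))
        (c n • fderiv ℝ χ (c n • x)) x := by
      have h2 := ((hχ.differentiable one_ne_zero) (c n • x)).hasFDerivAt.comp x
        ((hasFDerivAt_id x).const_smul (c n))
      convert! h2 using 1
      ext y
      simp
    have h3 : fderiv ℝ (v n) x = χ (c n • x) • fderiv ℝ φ x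
        + (c n • fderiv ℝ χ (c n • x)).smulRight (φ x) := (h1.smul (hφ' x).hasFDerivAt).fderiv
    rw [h3]
    refine (enorm_add_le (E := EuclideanSpace ℝ (Fin d) →L[ℝ] ℂ) _ _).trans ?_
    gcongr
    · rw [enorm_smul]
      exact mul_le_of_le_one_left' (hχ1 _)
    · rw [← ofReal_norm, ← ofReal_norm (φ x), ← ENNReal.ofReal_mul' (norm_nonneg _),
        ContinuousLinearMap.norm_smulRight_apply, norm_smul, Real.norm_of_nonneg (hc n).le]
      gcongr
      exact hK _
  have hDn : ∀ n, ∫⁻ x, ‖fderiv ℝ (v n) x‖ₑ ^ 2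
      ≤ (eLpNorm (fderiv ℝ φ) 2 volume + ENNReal.ofReal (c n * K) * eLpNorm φ 2 volume) ^ 2 :=
    fun n => by
    rw [lintegral_enorm_sq_eq]
    gcongr
    calc eLpNorm (fderiv ℝ (v n)) 2 volume
        ≤ eLpNorm ((fun x => ‖fderiv ℝ φ x‖) + (c n * K) • fun x => ‖φ x‖) 2 volume := by
          refine eLpNorm_mono_enorm fun x => (hder n x).trans ?_
          have hK0 : 0 ≤ K := (norm_nonneg _).trans (hK 0)
          have : 0 ≤ ‖fderiv ℝ φ x‖ + c n * K * ‖φ x‖ := by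
            have := (hc n).le
            positivity
          rw [← ofReal_norm, ← ofReal_norm (φ x), ← ENNReal.ofReal_mul' (norm_nonneg _),
            ← ENNReal.ofReal_add (norm_nonneg _) (by have := (hc n).le; positivity),
            ← ofReal_norm]
          simp only [Pi.add_apply, Pi.smul_apply, smul_eq_mul]
          rw [Real.norm_of_nonneg this]
      _ ≤ eLpNorm (fun x => ‖fderiv ℝ φ x‖) 2 volume
            + eLpNorm ((c n * K) • fun x => ‖φ x‖) 2 volume :=
          eLpNorm_add_le hφc.norm.aestronglyMeasurable
            (φ.continuous.norm.aestronglyMeasurable.const_smul _) (by norm_num)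
      _ = _ := by
          have hK0 : 0 ≤ K := (norm_nonneg _).trans (hK 0)
          rw [eLpNorm_const_smul, eLpNorm_norm, eLpNorm_norm, ← ofReal_norm,
            Real.norm_of_nonneg (mul_nonneg (hc n).le hK0)]
  have hNn : ∀ n, ∫⁻ x, ‖v n x‖ₑ ^ 2 ≤ ∫⁻ x, ‖φ x‖ₑ ^ 2 := fun n => by
    refine lintegral_mono fun x => ?_
    gcongr
    simp only [v, enorm_smul]
    exact mul_le_of_le_one_left' (hχ1 _)
  have hφ2 : eLpNorm φ 2 volume ≠ ∞ := (φ.memLp 2 volume).2.ne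
  have hφd2 : eLpNorm (fderiv ℝ φ) 2 volume ≠ ∞ :=
    ((SchwartzMap.fderivCLM ℝ (EuclideanSpace ℝ (Fin d)) ℂ φ).memLp 2 volume).2.ne
  refine WeightedBound.of_tendsto hγ (v := v) (N' := fun _ => ∫⁻ x, ‖φ x‖ₑ ^ 2)
    (D' := fun n =>
      (eLpNorm (fderiv ℝ φ) 2 volume + ENNReal.ofReal (c n * K) * eLpNorm φ 2 volume) ^ 2)
    (fun n => (hC (v n) (hv n) (hvc n)).mono hγ (hNn n) (hDn n))
    (fun n => (hv n).continuous.aestronglyMeasurable) ?_ tendsto_const_nhds ?_ ?_ ?_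
  · refine .of_forall fun x => tendsto_const_nhds.congr' ?_
    have h0 : Filter.Tendsto (fun n => c n • x) Filter.atTop (nhds 0) := by
      simpa using hc0.smul_const x
    filter_upwards [h0.eventually (Metric.closedBall_mem_nhds 0 one_pos)] with n hn
    simp only [v]
    rw [χ.one_of_mem_closedBall hn, one_smul]
  · rw [lintegral_enorm_sq_eq]
    have h1 : Filter.Tendsto (fun n => ENNReal.ofReal (c n * K)) Filter.atTop (nhds 0) := by
      have := ENNReal.tendsto_ofReal (hc0.mul_const K)
      simpa using this
    have h2 := ENNReal.Tendsto.mul_const h1 (.inr hφ2)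
    have h3 := (tendsto_const_nhds (x := eLpNorm (fderiv ℝ φ) 2 volume)).add h2
    simpa using ENNReal.Tendsto.pow (n := 2) h3
  · rw [lintegral_enorm_sq_eq]; exact ENNReal.pow_ne_top hφ2
  · rw [lintegral_enorm_sq_eq]; exact ENNReal.pow_ne_top hφd2

/-- Operator norm against Hilbert–Schmidt norm. It passes from the norm of `fderiv` to the sum over
partial derivatives; the inequality can be strict, since `L` is complex-valued on a real space. -/
theorem enorm_sq_le_sum_single (L : EuclideanSpace ℝ (Fin d) →L[ℝ] ℂ) :
    ‖L‖ₑ ^ 2 ≤ ∑ j, ‖L (EuclideanSpace.single j (1 : ℝ))‖ₑ ^ 2 := by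
  have h : ‖L‖ ^ 2 ≤ ∑ j, ‖L (EuclideanSpace.single j (1 : ℝ))‖ ^ 2 := by
    have h1 : ‖L‖ ≤ √(∑ j, ‖L (EuclideanSpace.single j (1 : ℝ))‖ ^ 2) := by
      refine L.opNorm_le_bound (Real.sqrt_nonneg _) fun x => ?_
      have hx : x = ∑ j, x j • EuclideanSpace.single j (1 : ℝ) := by
        have := (EuclideanSpace.basisFun (Fin d) ℝ).sum_repr x
        simpa using this.symm
      calc ‖L x‖ = ‖∑ j, x j • L (EuclideanSpace.single j (1 : ℝ))‖ := by
            conv_lhs => rw [hx]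
            simp [map_sum]
        _ ≤ ∑ j, ‖L (EuclideanSpace.single j (1 : ℝ))‖ * ‖x j‖ := by
            refine (norm_sum_le _ _).trans (le_of_eq ?_)
            refine Finset.sum_congr rfl fun j _ => ?_
            rw [norm_smul, mul_comm]
        _ ≤ _ := by
            rw [EuclideanSpace.norm_eq]
            exact Real.sum_mul_le_sqrt_mul_sqrt _ _ _
    calc ‖L‖ ^ 2 ≤ _ := pow_le_pow_left₀ (norm_nonneg _) h1 2
      _ = _ := Real.sq_sqrt (by positivity)
  have h2 := ENNReal.ofReal_le_ofReal h
  rw [ENNReal.ofReal_sum_of_nonneg (fun _ _ => by positivity)] at h2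
  simpa [ENNReal.ofReal_pow, ofReal_norm] using h2

theorem IsWeakGrad.weightedBound (hγ : 0 ≤ γ)
    (hC : ∀ u : EuclideanSpace ℝ (Fin d) → ℂ, ContDiff ℝ 1 u → HasCompactSupport u →
      WeightedBound d γ C u (∫⁻ x, ‖u x‖ₑ ^ 2) (∫⁻ x, ‖fderiv ℝ u x‖ₑ ^ 2))
    {u : Scalar d} {g : Fin d → Scalar d} (h : IsWeakGrad u g) :
    WeightedBound d γ C u (ENNReal.ofReal (‖u‖ ^ 2)) (ENNReal.ofReal (∑ j, ‖g j‖ ^ 2)) := by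
  obtain ⟨φ, hφ, hφ'⟩ := h.exists_schwartz_tendsto
  -- Fatou needs pointwise convergence, which `L²` convergence gives along a subsequence.
  obtain ⟨ns, hns, hae⟩ := (tendstoInMeasure_of_tendsto_Lp hφ).exists_seq_tendsto_ae
  have hmeas : ∀ n (j : Fin d), AEMeasurable
      (fun x => ‖(∂_{(EuclideanSpace.single j (1 : ℝ) : EuclideanSpace ℝ (Fin d))} (φ n)) x‖ₑ ^ 2)
      volume := fun n j =>
    ((∂_{(EuclideanSpace.single j (1 : ℝ) : EuclideanSpace ℝ (Fin d))} (φ n)).continuous.enorm.aemeasurable.pow_const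
      2)
  have hS : ∀ ψ : 𝓢(EuclideanSpace ℝ (Fin d), ℂ),
      ∫⁻ x, ‖ψ x‖ₑ ^ 2 = ENNReal.ofReal (‖ψ.toLp 2 volume‖ ^ 2) := fun ψ => by
    rw [← lintegral_enorm_sq_eq_norm]
    refine lintegral_congr_ae ?_
    filter_upwards [ψ.coeFn_toLp 2 volume] with x hx
    rw [hx]
  have hb : ∀ n, WeightedBound d γ C (φ n) (ENNReal.ofReal (‖(φ n).toLp 2 volume‖ ^ 2))
      (ENNReal.ofReal (∑ j : Fin d,
        ‖(∂_{(EuclideanSpace.single j (1 : ℝ) : EuclideanSpace ℝ (Fin d))} (φ n)).toLp 2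
          volume‖ ^ 2)) := fun n => by
    refine (weightedBound_schwartz hγ hC (φ n)).mono hγ (hS _).le ?_
    rw [ENNReal.ofReal_sum_of_nonneg (fun _ _ => by positivity)]
    simp only [← hS]
    rw [← lintegral_finsetSum' _ fun j _ => hmeas n j]
    exact lintegral_mono fun x => enorm_sq_le_sum_single _
  refine WeightedBound.of_tendsto hγ (fun n => hb (ns n))
    (fun n => (φ (ns n)).continuous.aestronglyMeasurable) ?_ ?_ ?_ ENNReal.ofReal_ne_top
    ENNReal.ofReal_ne_top
  · have hall : ∀ᵐ x ∂volume, ∀ n, (φ n).toLp 2 volume x = φ n x :=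
      ae_all_iff.2 fun n => (φ n).coeFn_toLp 2 volume
    filter_upwards [hae, hall] with x hx hx'
    simpa only [hx'] using hx
  · exact ENNReal.tendsto_ofReal (((hφ.comp hns.tendsto_atTop).norm).pow 2)
  · exact ENNReal.tendsto_ofReal (tendsto_finsetSum _ fun j _ =>
      (((hφ' j).comp hns.tendsto_atTop).norm).pow 2)

end Extension

/-! ### Vector fields, coercivity of the Lamé form and the bound for eigenvalues. -/

section Eigenvalue

variable {d : ℕ} {γ : ℝ}

theorem norm_component_le (i : Fin d) (u : VField d) : ‖component i u‖ ≤ ‖u‖ := by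
  refine Lp.norm_le_norm_of_ae_le ?_
  filter_upwards [coeFn_component i u] with x hx
  rw [hx]
  exact PiLp.norm_apply_le (u x) i

theorem enorm_sq_eq_sum (v : EuclideanSpace ℂ (Fin d)) : ‖v‖ₑ ^ 2 = ∑ i, ‖v i‖ₑ ^ 2 := by
  have h := congrArg ENNReal.ofReal (EuclideanSpace.norm_sq_eq v)
  rw [ENNReal.ofReal_sum_of_nonneg (fun _ _ => by positivity)] at h
  simpa [ENNReal.ofReal_pow, ofReal_norm] using h

theorem integral_norm_sq_eq {X F : Type*} [MeasurableSpace X] {ν : Measure X}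
    [NormedAddCommGroup F] (f : Lp F 2 ν) : ∫ x, ‖f x‖ ^ 2 ∂ν = ‖f‖ ^ 2 := by
  rw [integral_eq_lintegral_of_nonneg_ae (f := fun x => ‖f x‖ ^ 2)
    (.of_forall fun x => by positivity) ((Lp.aestronglyMeasurable f).norm.pow 2)]
  simp only [ENNReal.ofReal_pow (norm_nonneg _), ofReal_norm]
  rw [lintegral_enorm_sq_eq_norm, ENNReal.toReal_ofReal (by positivity)]

theorem sum_norm_component_sq (u : VField d) : ∑ i, ‖component i u‖ ^ 2 = ‖u‖ ^ 2 := by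
  have h : ∑ i, ENNReal.ofReal (‖component i u‖ ^ 2) = ENNReal.ofReal (‖u‖ ^ 2) := by
    simp only [← lintegral_enorm_sq_eq_norm]
    rw [← lintegral_finsetSum' _ fun i _ => (Lp.aestronglyMeasurable _).enorm.pow_const 2]
    refine lintegral_congr_ae ?_
    filter_upwards [ae_all_iff.2 fun i => coeFn_component i u] with x hx
    simp only [hx, enorm_sq_eq_sum]
  rw [← ENNReal.ofReal_sum_of_nonneg (fun _ _ => by positivity)] at h
  exact (ENNReal.ofReal_eq_ofReal_iff (Finset.sum_nonneg fun _ _ => by positivity)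
    (by positivity)).1 h

/-- `∫ |div u|² ≤ ∫ |∇u|²`. -/
theorem integral_weakDiv_sq_le {u : VField d} (hu : u ∈ H1 d) :
    ∫ x, ‖weakDiv u x‖ ^ 2 ≤ ∑ j, ‖weakPartial j u‖ ^ 2 := by
  set S : Scalar d := ∑ j, component j (weakPartial j u) with hS
  have hae : weakDiv u =ᵐ[volume] S := by
    have h1 : (S : EuclideanSpace ℝ (Fin d) → ℂ) =ᵐ[volume]
        fun x => ∑ j, component j (weakPartial j u) x := by
      rw [hS]
      exact Lp.coeFn_fun_finsetSum Finset.univ fun j => component j (weakPartial j u)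
    filter_upwards [h1, ae_all_iff.2 fun j => coeFn_component j (weakPartial j u)] with x hx hx'
    rw [hx, weakDiv]
    exact Finset.sum_congr rfl fun j _ => (hx' j).symm
  have h2 : ∫ x, ‖weakDiv u x‖ ^ 2 = ‖S‖ ^ 2 := by
    rw [integral_congr_ae (hae.mono fun x hx => by simp only [hx] :
      (fun x => ‖weakDiv u x‖ ^ 2) =ᵐ[volume] fun x => ‖S x‖ ^ 2)]
    exact integral_norm_sq_eq S
  have h4 : ‖S‖ ^ 2 = ∑ j, ∑ k, Complex.re (inner ℂ (component j (weakPartial k u))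
      (component k (weakPartial j u))) := by
    have h5 : ((‖S‖ ^ 2 : ℝ) : ℂ) = inner ℂ S S := by
      rw [inner_self_eq_norm_sq_to_K]; push_cast; rfl
    rw [← Complex.ofReal_re (‖S‖ ^ 2), h5, hS, sum_inner, Complex.re_sum]
    refine Finset.sum_congr rfl fun j _ => ?_
    rw [inner_sum, Complex.re_sum]
    refine Finset.sum_congr rfl fun k _ => ?_
    -- Turns `⟨∂ⱼ uⱼ, ∂ₖ uₖ⟩` into `⟨∂ₖ uⱼ, ∂ⱼ uₖ⟩`. After `2ab ≤ a² + b²`, each `‖∂ⱼ uₖ‖²` is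
    -- counted once in each of the two double sums, so no factor `d` is lost.
    rw [(isWeakGrad_component hu j).inner_comm (isWeakGrad_component hu k) j k]
  have h6 : ∑ j, ‖weakPartial j u‖ ^ 2
      = ∑ j : Fin d, ∑ k, ‖component k (weakPartial j u)‖ ^ 2 :=
    Finset.sum_congr rfl fun j _ => (sum_norm_component_sq _).symm
  have h7 : ∑ j : Fin d, ∑ k, ‖component k (weakPartial j u)‖ ^ 2
      = ∑ j : Fin d, ∑ k, ‖component j (weakPartial k u)‖ ^ 2 := Finset.sum_comm
  have h8 : 2 * ‖S‖ ^ 2 ≤ ∑ j : Fin d, ∑ k, ‖component k (weakPartial j u)‖ ^ 2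
      + ∑ j : Fin d, ∑ k, ‖component j (weakPartial k u)‖ ^ 2 := by
    rw [h4, Finset.mul_sum, ← Finset.sum_add_distrib]
    refine Finset.sum_le_sum fun j _ => ?_
    rw [Finset.mul_sum, ← Finset.sum_add_distrib]
    refine Finset.sum_le_sum fun k _ => ?_
    have h9 : Complex.re (inner ℂ (component j (weakPartial k u)) (component k (weakPartial j u)))
        ≤ ‖component j (weakPartial k u)‖ * ‖component k (weakPartial j u)‖ :=
      (Complex.re_le_norm _).trans (norm_inner_le_norm _ _)
    nlinarith [sq_nonneg (‖component j (weakPartial k u)‖ - ‖component k (weakPartial j u)‖)]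
  rw [h2, h6]
  linarith

/-- The weighted Gagliardo–Nirenberg inequality for vector fields in `H¹`. -/
theorem exists_vectorField_weightedBound
    (hγ : (d = 1 ∧ 1 / 2 ≤ γ) ∨ (d = 2 ∧ 0 < γ) ∨ (3 ≤ d ∧ 0 ≤ γ)) :
    ∃ K : ℝ≥0, ∀ w : EuclideanSpace ℝ (Fin d) → ℝ, AEMeasurable w volume →
      ∫⁻ x, ‖w x‖ₑ ^ (γ + d / 2) ≠ ∞ → ∀ u ∈ H1 d,
        ∫⁻ x, ‖w x‖ₑ * ‖u x‖ₑ ^ 2 ≤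
          K * (∫⁻ x, ‖w x‖ₑ ^ (γ + d / 2)) ^ (1 / (γ + d / 2)) *
          (ENNReal.ofReal (‖u‖ ^ 2) ^ (γ / (γ + d / 2)) *
            ENNReal.ofReal (∑ j, ‖weakPartial j u‖ ^ 2) ^ (d / 2 / (γ + d / 2))) := by
  obtain ⟨C, hC⟩ := exists_weightedBound hγ
  have hγ0 : 0 ≤ γ := by rcases hγ with ⟨_, h⟩ | ⟨_, h⟩ | ⟨_, h⟩ <;> linarith
  -- The factor `d` comes from bounding each of the `d` components by the full norms of `u` and its
  -- gradient.
  refine ⟨d * C, fun w hw hw' u hu => ?_⟩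
  have h1 : ∀ i, WeightedBound d γ C (component i u) (ENNReal.ofReal (‖u‖ ^ 2))
      (ENNReal.ofReal (∑ j, ‖weakPartial j u‖ ^ 2)) := fun i => by
    refine ((isWeakGrad_component hu i).weightedBound hγ0 hC).mono hγ0 ?_ ?_
    · gcongr
      exact norm_component_le i u
    · gcongr
      exact norm_component_le i _
  calc ∫⁻ x, ‖w x‖ₑ * ‖u x‖ₑ ^ 2 = ∑ i, ∫⁻ x, ‖w x‖ₑ * ‖component i u x‖ₑ ^ 2 := by
        rw [← lintegral_finsetSum' (f := fun i x => ‖w x‖ₑ * ‖component i u x‖ₑ ^ 2) _ fun i _ =>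
          hw.enorm.mul ((Lp.aestronglyMeasurable _).enorm.pow_const 2)]
        refine lintegral_congr_ae ?_
        filter_upwards [ae_all_iff.2 fun i => coeFn_component i u] with x hx
        simp only [hx, enorm_sq_eq_sum, Finset.mul_sum]
    _ ≤ ∑ i : Fin d, _ := Finset.sum_le_sum fun i _ => h1 i w hw hw'
    _ = _ := by
        rw [Finset.sum_const, Finset.card_univ, Fintype.card_fin, nsmul_eq_mul]
        push_cast
        ring

theorem exists_integral_weightedBound
    (hγ : (d = 1 ∧ 1 / 2 ≤ γ) ∨ (d = 2 ∧ 0 < γ) ∨ (3 ≤ d ∧ 0 ≤ γ)) :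
    ∃ K : ℝ≥0, ∀ w : EuclideanSpace ℝ (Fin d) → ℝ, AEMeasurable w volume → (∀ x, 0 ≤ w x) →
      ∫⁻ x, ‖w x‖ₑ ^ (γ + d / 2) ≠ ∞ → ∀ u ∈ H1 d,
        Integrable (fun x => w x * ‖u x‖ ^ 2) volume →
        ∫ x, w x * ‖u x‖ ^ 2 ≤
          K * (∫⁻ x, ‖w x‖ₑ ^ (γ + d / 2)).toReal ^ (1 / (γ + d / 2)) *
          ((‖u‖ ^ 2) ^ (γ / (γ + d / 2)) *
            (∑ j, ‖weakPartial j u‖ ^ 2) ^ (d / 2 / (γ + d / 2))) := by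
  obtain ⟨K, hK⟩ := exists_vectorField_weightedBound hγ
  have hγ0 : 0 ≤ γ := by rcases hγ with ⟨_, h⟩ | ⟨_, h⟩ | ⟨_, h⟩ <;> linarith
  refine ⟨K, fun w hw hw0 hfin u hu hint => ?_⟩
  have hG : 0 ≤ ∑ j, ‖weakPartial j u‖ ^ 2 := Finset.sum_nonneg fun _ _ => by positivity
  have h1 : ∫ x, w x * ‖u x‖ ^ 2 = (∫⁻ x, ‖w x‖ₑ * ‖u x‖ₑ ^ 2).toReal := by
    rw [integral_eq_lintegral_of_nonneg_ae
      (.of_forall fun x => mul_nonneg (hw0 x) (by positivity)) hint.1]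
    congr 1
    refine lintegral_congr fun x => ?_
    rw [ENNReal.ofReal_mul (hw0 x), ENNReal.ofReal_pow (norm_nonneg _), ofReal_norm,
      ← ofReal_norm (w x), Real.norm_of_nonneg (hw0 x)]
  have htop : K * (∫⁻ x, ‖w x‖ₑ ^ (γ + d / 2)) ^ (1 / (γ + d / 2)) *
      (ENNReal.ofReal (‖u‖ ^ 2) ^ (γ / (γ + d / 2)) *
        ENNReal.ofReal (∑ j, ‖weakPartial j u‖ ^ 2) ^ ((d : ℝ) / 2 / (γ + d / 2))) ≠ ∞ := by
    refine ENNReal.mul_ne_top (ENNReal.mul_ne_top ENNReal.coe_ne_top ?_) (ENNReal.mul_ne_top ?_ ?_)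
    · exact ENNReal.rpow_ne_top_of_nonneg (by positivity) hfin
    · exact ENNReal.rpow_ne_top_of_nonneg (by positivity) ENNReal.ofReal_ne_top
    · exact ENNReal.rpow_ne_top_of_nonneg (by positivity) ENNReal.ofReal_ne_top
  rw [h1]
  refine (ENNReal.toReal_mono htop (hK w hw hfin u hu)).trans (le_of_eq ?_)
  rw [ENNReal.toReal_mul, ENNReal.toReal_mul, ENNReal.toReal_mul, ← ENNReal.toReal_rpow,
    ← ENNReal.toReal_rpow, ← ENNReal.toReal_rpow, ENNReal.toReal_ofReal (by positivity),
    ENNReal.toReal_ofReal hG, ENNReal.coe_toReal]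

/-- Coercivity of the kinetic energy, as an a priori bound for eigenfunctions. -/
theorem kinetic_add_le_of_mem_lameGraph {lam mu : ℝ} {V : EuclideanSpace ℝ (Fin d) → ℝ} {z : ℝ}
    {u : VField d} (h : (u, (z : ℂ) • u) ∈ lameGraph lam mu V) :
    min mu (lam + 2 * mu) * ∑ j, ‖weakPartial j u‖ ^ 2 - z * ‖u‖ ^ 2 ≤
      ∫ x, max (-V x) 0 * ‖u x‖ ^ 2 ∧ Integrable (fun x => max (-V x) 0 * ‖u x‖ ^ 2) volume := by
  obtain ⟨hQ, -, hf⟩ := h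
  have hint : Integrable (fun x => max (-V x) 0 * ‖u x‖ ^ 2) volume := by
    refine hQ.2.neg.pos_part.congr (.of_forall fun x => ?_)
    simp only [Pi.neg_apply]
    rw [← neg_mul, max_mul_of_nonneg _ _ (by positivity), zero_mul]
  refine ⟨?_, hint⟩
  have h1 := congrArg Complex.re (hf u hQ)
  have e1 : ∀ v : VField d, inner ℂ v v = ((‖v‖ ^ 2 : ℝ) : ℂ) := fun v => by
    rw [inner_self_eq_norm_sq_to_K]; push_cast; rfl
  have e2 : ∫ x, conj (weakDiv u x) * weakDiv u x = ((∫ x, ‖weakDiv u x‖ ^ 2 : ℝ) : ℂ) := by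
    rw [← integral_complex_ofReal]
    refine integral_congr_ae (.of_forall fun x => ?_)
    simp only
    rw [mul_comm, Complex.mul_conj, Complex.normSq_eq_norm_sq]
  have e3 : ∫ x, (V x : ℂ) * inner ℂ (u x) (u x) = ((∫ x, V x * ‖u x‖ ^ 2 : ℝ) : ℂ) := by
    rw [← integral_complex_ofReal]
    refine integral_congr_ae (.of_forall fun x => ?_)
    simp only
    rw [inner_self_eq_norm_sq_to_K]
    push_cast
    rfl
  simp only at h1
  rw [lameForm, e2, e3, inner_smul_right, e1] at h1
  simp only [e1] at h1
  rw [← Complex.ofReal_sum, ← Complex.ofReal_mul, ← Complex.ofReal_mul, ← Complex.ofReal_mul,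
    ← Complex.ofReal_add, ← Complex.ofReal_add, Complex.ofReal_re, Complex.ofReal_re] at h1
  have h2 := integral_weakDiv_sq_le hQ.1
  have h3 : 0 ≤ ∫ x, ‖weakDiv u x‖ ^ 2 := integral_nonneg fun x => by positivity
  have h4 : -∫ x, V x * ‖u x‖ ^ 2 ≤ ∫ x, max (-V x) 0 * ‖u x‖ ^ 2 := by
    rw [← integral_neg]
    refine integral_mono hQ.2.neg hint fun x => ?_
    simp only
    rw [← neg_mul]
    gcongr
    exact le_max_left _ _
  set G := ∑ j, ‖weakPartial j u‖ ^ 2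
  have hG : 0 ≤ G := Finset.sum_nonneg fun _ _ => by positivity
  -- If `lam + mu ≥ 0` the divergence term is dropped; otherwise it is at least `(lam + mu) * G`,
  -- and `mu + (lam + mu) = lam + 2 * mu`.
  have h5 : min mu (lam + 2 * mu) * G ≤ mu * G + (lam + mu) * ∫ x, ‖weakDiv u x‖ ^ 2 := by
    rcases le_total 0 (lam + mu) with hs | hs
    · have := mul_le_mul_of_nonneg_right (min_le_left mu (lam + 2 * mu)) hG
      have := mul_nonneg hs h3
      linarith
    · have := mul_le_mul_of_nonneg_right (min_le_right mu (lam + 2 * mu)) hG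
      have := mul_le_mul_of_nonpos_left h2 hs
      linarith
  linarith

/-- With `X = c G + y n` one has `n ≤ X / y` and `G ≤ X / c`. As `s + t = 1`, the right side of `h`
is at most `X` times a constant, and the positive `X` cancels. The case `G = 0` needs no separate
treatment. -/
theorem rpow_le_of_le_mul_rpow {c y n G A s t : ℝ} (hc : 0 < c) (hy : 0 < y) (hn : 0 < n)
    (hG : 0 ≤ G) (hA : 0 ≤ A) (hs : 0 ≤ s) (ht : 0 ≤ t) (hst : s + t = 1)
    (h : c * G + y * n ≤ A * (n ^ s * G ^ t)) : y ^ s ≤ A * (1 / c) ^ t := by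
  set X := c * G + y * n with hX
  have hX0 : 0 < X := by positivity
  have h1 : n ≤ X * (1 / y) := by
    rw [mul_one_div, le_div_iff₀ hy]
    have := mul_nonneg hc.le hG
    linarith
  have h2 : G ≤ X * (1 / c) := by
    rw [mul_one_div, le_div_iff₀ hc]
    have := mul_pos hy hn
    linarith
  have h3 : n ^ s * G ^ t ≤ X * ((1 / y) ^ s * (1 / c) ^ t) := by
    calc n ^ s * G ^ t ≤ (X * (1 / y)) ^ s * (X * (1 / c)) ^ t := by gcongr
      _ = X ^ (s + t) * ((1 / y) ^ s * (1 / c) ^ t) := by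
          rw [Real.mul_rpow hX0.le (by positivity), Real.mul_rpow hX0.le (by positivity),
            Real.rpow_add hX0]
          ring
      _ = _ := by rw [hst, Real.rpow_one]
  have h4 : X * 1 ≤ X * (A * ((1 / y) ^ s * (1 / c) ^ t)) := by
    calc X * 1 ≤ A * (n ^ s * G ^ t) := by rw [mul_one]; exact h
      _ ≤ A * (X * ((1 / y) ^ s * (1 / c) ^ t)) := by gcongr
      _ = _ := by ring
  have h5 := le_of_mul_le_mul_left h4 hX0
  have hys : 0 < y ^ s := by positivity
  rw [Real.div_rpow zero_le_one hy.le, Real.one_rpow] at h5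
  have h6 : y ^ s * 1 ≤ y ^ s * (A * (1 / y ^ s * (1 / c) ^ t)) := by gcongr
  calc y ^ s = y ^ s * 1 := by ring
    _ ≤ _ := h6
    _ = _ := by field_simp

end Eigenvalue

end Lame

end

/-! ### The eigenvalue bound. -/

theorem mainTheorem6 (d : ℕ) (γ lam mu : ℝ)
    (hγ : (d = 1 ∧ 1 / 2 ≤ γ) ∨ (d = 2 ∧ 0 < γ) ∨ (3 ≤ d ∧ 0 ≤ γ))
    (hmu : 0 < mu) (hlam : 0 < lam + 2 * mu) :
    ∃ C : ℝ, 0 < C ∧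
      ∀ V : EuclideanSpace ℝ (Fin d) → ℝ, AEMeasurable V →
        ∀ z : ℝ, z < 0 → Lame.IsEigenvalue (Lame.lameOperator lam mu V) (z : ℂ) →
          ENNReal.ofReal (|z| ^ γ) ≤
            ENNReal.ofReal C *
              eLpNorm (fun x => max (-V x) 0) (ENNReal.ofReal (γ + d / 2)) volume
                ^ (γ + (d : ℝ) / 2) := by
  obtain ⟨K, hK⟩ := Lame.exists_integral_weightedBound hγ
  have hγ0 : 0 ≤ γ := by rcases hγ with ⟨_, h⟩ | ⟨_, h⟩ | ⟨_, h⟩ <;> linarith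
  have hd : 0 < (d : ℝ) := by
    have : 0 < d := by omega
    exact_mod_cast this
  have hp : 0 < γ + (d : ℝ) / 2 := by positivity
  set p := γ + (d : ℝ) / 2 with hp_def
  set c := min mu (lam + 2 * mu) with hc_def
  have hc : 0 < c := lt_min hmu hlam
  set B : ℝ := K * (1 / c) ^ ((d : ℝ) / 2 / p) with hB
  have hB0 : 0 ≤ B := by positivity
  -- The proof yields the constant `B ^ p`, which could vanish; adding `1` makes it positive, so
  -- that the right side is `∞` when `V₋ ∉ L^p`.
  refine ⟨B ^ p + 1, by positivity, fun V hV z hz hev => ?_⟩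
  obtain ⟨u, hu0, hu⟩ := hev
  have hgraph : ((u : Lame.VField d), (z : ℂ) • (u : Lame.VField d)) ∈ Lame.lameGraph lam mu V := by
    rw [← Lame.lameOperator_graph, ← hu]
    exact LinearPMap.mem_graph _ u
  obtain ⟨hkin, hint⟩ := Lame.kinetic_add_le_of_mem_lameGraph hgraph
  have hw : AEMeasurable (fun x => max (-V x) 0) volume := hV.neg.max aemeasurable_const
  have hnorm : eLpNorm (fun x => max (-V x) 0) (ENNReal.ofReal p) volume ^ p
      = ∫⁻ x, ‖max (-V x) 0‖ₑ ^ p := by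
    have h := eLpNorm_nnreal_pow_eq_lintegral (f := fun x => max (-V x) 0) (μ := volume)
      (p := p.toNNReal) (Real.toNNReal_pos.2 hp).ne'
    rwa [Real.coe_toNNReal _ hp.le] at h
  rw [hnorm]
  by_cases hfin : ∫⁻ x, ‖max (-V x) 0‖ₑ ^ p = ⊤
  · rw [hfin, ENNReal.mul_top]
    · exact le_top
    · exact (ENNReal.ofReal_pos.2 (by positivity)).ne'
  set M := (∫⁻ x, ‖max (-V x) 0‖ₑ ^ p).toReal with hM
  have hM0 : 0 ≤ M := ENNReal.toReal_nonneg
  have hMe : ∫⁻ x, ‖max (-V x) 0‖ₑ ^ p = ENNReal.ofReal M := (ENNReal.ofReal_toReal hfin).symm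
  have hb := hK _ hw (fun x => le_max_right _ _) hfin u hgraph.1.1 hint
  rw [← hM] at hb
  set n := ‖(u : Lame.VField d)‖ ^ 2 with hn
  set G := ∑ j, ‖Lame.weakPartial j (u : Lame.VField d)‖ ^ 2 with hG
  have hn0 : 0 < n := by have := norm_pos_iff.2 hu0; positivity
  have hG0 : 0 ≤ G := Finset.sum_nonneg fun _ _ => by positivity
  have hs : 0 ≤ γ / p := by positivity
  have ht : 0 ≤ (d : ℝ) / 2 / p := by positivity
  -- The kinetic lower bound and the weighted upper bound meet here, with `y = |z| = -z`, `s = γ /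
  -- p` and `t = d / (2p)`.
  have hmain := Lame.rpow_le_of_le_mul_rpow hc (abs_pos.2 hz.ne) hn0 hG0
    (by positivity : 0 ≤ (K : ℝ) * M ^ (1 / p)) hs ht (by rw [← add_div, ← hp_def, div_self hp.ne'])
    (by rw [abs_of_neg hz]; linarith)
  have hfinal : |z| ^ γ ≤ B ^ p * M := by
    calc |z| ^ γ = (|z| ^ (γ / p)) ^ p := by
          rw [← Real.rpow_mul (abs_nonneg z), div_mul_cancel₀ _ hp.ne']
      _ ≤ (K * M ^ (1 / p) * (1 / c) ^ ((d : ℝ) / 2 / p)) ^ p := by gcongr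
      _ = (B * M ^ (1 / p)) ^ p := by rw [hB]; ring_nf
      _ = B ^ p * M := by
          rw [Real.mul_rpow hB0 (by positivity), ← Real.rpow_mul hM0, one_div_mul_cancel hp.ne',
            Real.rpow_one]
  rw [hMe, ← ENNReal.ofReal_mul (by positivity)]
  refine ENNReal.ofReal_le_ofReal (hfinal.trans ?_)
  gcongr
  linarith
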